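/- Let $n\ge 1$. A degree sequence of length $n$ is a vector $\mathcal D=(d_1,\dots,d_n)$ of positive integers such that at least one simple graph on the vertex set $[n]=\{1,\dots,n\}$ has the property that vertex $i$ has degree $d_i$ for every $i\in[n]$. Let $G^{\mathcal D}$ be a graph chosen uniformly at random among all simple graphs on $[n]$ with this property. For $p\in(0,1)$ let $G^{\mathcal D}_p$ be the random spanning subgraph obtained by first choosing $G^{\mathcal D}$ and then retaining each of its edges independently with probability $p$. For a graph $G$, let $L_1(G)$ be the number of vertices in a largest connected component of $G$. Throughout, $\log$ is the natural logarithm and $\log^2 n=(\log n)^2$. **Proposition.** For all $p,\delta,\epsilon\in(0,1)$ and all real $\bar d\ge 1$, there exist $\gamma>0$ and an integer $n_0\ge 1$ such that for every integer $n\ge n_0$ and every degree sequence $\mathcal D=(d_1,\dots,d_n)$ with $$\sum_{i=1}^n d_i\le \bar d\,n\qquad\text{and}\qquad \sum_{i\,:\,d_i\ge \log^2 n} d_i\ \ge\ \epsilon n,$$ we have $$\mathbb P\big[L_1(G^{\mathcal D}_p)>\gamma n\big]\ \ge\ 1-\delta .$$ -/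

import Mathlib

open MeasureTheory ProbabilityTheory

namespace DegreePercolation

open Classical in
/-- The set of all simple graphs on the vertex set `Fin n` in which vertex `i` has degree `d i`
for every `i`. -/
def graphsWithDegrees {n : ℕ} (d : Fin n → ℕ) : Set (SimpleGraph (Fin n)) :=
  {G | ∀ i, G.degree i = d i}

/-- A degree sequence of length `n`: positive integers `d i` that are feasible, that is, realised by
at least one simple graph. -/
structure IsDegreeSequence {n : ℕ} (d : Fin n → ℕ) : Prop where
  one_le : ∀ i, 1 ≤ d i
  feasible : (graphsWithDegrees d).Nonempty

/-- `W(c, d)`: the set of vertices of degree at least `c`. -/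
noncomputable def highDegree {n : ℕ} (c : ℝ) (d : Fin n → ℕ) : Finset (Fin n) :=
  {i | c ≤ (d i : ℝ)}

/-- Bond percolation: the law of the random spanning subgraph `G_p` of `G` in which every edge of
`G` is retained independently with probability `p`. -/
noncomputable def percolation {V : Type*} (G : SimpleGraph V) (p : unitInterval) :
    Measure (SimpleGraph V) :=
  (setBernoulli G.edgeSet p).map SimpleGraph.fromEdgeSet

/-- The law of `G^d_p`: first choose a graph uniformly at random among all simple graphs with
degree sequence `d`, then retain each of its edges independently with probability `p`. -/
noncomputable def percolatedGraphLaw {n : ℕ} (d : Fin n → ℕ) (p : unitInterval) :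
    Measure (SimpleGraph (Fin n)) :=
  (uniformOn (graphsWithDegrees d)).bind fun G => percolation G p

/-- `L₁(G)`: the number of vertices in a largest connected component of `G`
(for a graph on a finite vertex set). -/
noncomputable def largestComponentCard {V : Type*} (G : SimpleGraph V) : ℕ :=
  ⨆ C : G.ConnectedComponent, C.supp.ncard

end DegreePercolation

/-!
Let `L` be the vertices of bounded degree and `Y` those of degree at least a large constant `D`. As
all degrees are positive and their sum is linear, `L` contains at least half of the vertices.

If some vertex has linear degree, its component in the percolated graph is already linear
(`percolation_largestComponentCard_le_of_degree`). Otherwise two facts about the uniform graph with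
the given degrees are proved by switching pairs of edges.

* Linearly many edges join `Y` and `L` (`two_pow_mul_card_few_edges_le`).
* Let `A`, `B` be disjoint sets of vertices of large degree, each of linear total degree, and all
  having a fair share of their neighbours in `L`. An edge from `a ∈ A` to `x ∈ L` and an edge from
  `b ∈ B` to `y ∈ L` can be replaced by `ab` and `xy`, and `x`, `y` are rarely adjacent since
  vertices of `L` have bounded degree. Hence the probability that fewer than `T` edges join `A` and
  `B` is at most `2 ^ (-T)`, where `T` is a large multiple of the number of vertices considered
  (`two_pow_mul_card_few_cross_edges_le`). As there are at most `4 ^ s` pairs of subsets of a set of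
  size `s`, the bound holds simultaneously for all such pairs which make up a positive proportion of
  one of the sets `{v ∈ Y | t ≤ d v}` (`card_exists_heavyPair_few_cross_edges_le`). Considering only
  pairs which make up such a proportion keeps vertices without neighbours in `L` from spoiling the
  union bound.

Fix a graph with these two properties. The vertices of `Y` with a fair share of their neighbours in
`L`, intersected with a suitable threshold set, form a set `R` with linearly many edges to `L`
(`exists_threshold`), and percolation keeps a positive proportion of these edges. If all components
of the percolated graph were small, then `R` could be split along components into `A` and `B` with
linearly many retained edges to `L` each (`exists_split_of_small_components`). But many edges of the
graph join `A` and `B`, and by a union bound over the splittings of `R`, it is unlikely that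
percolation deletes all of them for any splitting
(`percolation_largestComponentCard_le_of_cross`).

The lower bound `log² n` on the degrees of the hypothesis enters only through the fact that it
exceeds `2 D` for large `n`.
-/

namespace DegreePercolation

/-! ### Switchings and double counting -/

open scoped Classical in
/-- The switching at the vertices `a, x, b, y`: the symmetric difference of `G` with the closed walk
`a x y b`. When `ax`, `by` are edges and `ab`, `xy` are not, it replaces the former two by the
latter two. Being a symmetric difference, it is an involution. -/
def switch {V : Type*} (G : SimpleGraph V) (a x b y : V) : SimpleGraph V where
  Adj u v := Xor (G.Adj u v)
    (u ≠ v ∧ (s(u, v) = s(a, x) ∨ s(u, v) = s(b, y) ∨ s(u, v) = s(a, b) ∨ s(u, v) = s(x, y)))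
  symm := ⟨fun u v h => by
    rw [Sym2.eq_swap, G.adj_comm, ne_comm]; exact h⟩
  loopless := ⟨fun u h => by simp [Xor] at h⟩

/-- The edges `ax`, `by` of `G` may be replaced by the non-edges `ab`, `xy`. -/
structure Switchable {V : Type*} (G : SimpleGraph V) (a x b y : V) : Prop where
  adj_ax : G.Adj a x
  adj_by : G.Adj b y
  ne_ab : a ≠ b
  ne_xy : x ≠ y
  not_ab : ¬ G.Adj a b
  not_xy : ¬ G.Adj x y

section Switch

variable {V : Type*} {G : SimpleGraph V} {a x b y : V}

lemma switch_switch : switch (switch G a x b y) a x b y = G := by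
  ext u v
  simp only [switch]
  generalize (u ≠ v ∧ _) = P
  unfold Xor
  tauto

lemma switch_injective : Function.Injective fun G : SimpleGraph V => switch G a x b y :=
  Function.LeftInverse.injective (g := fun G => switch G a x b y) fun _ => switch_switch

lemma switch_comm : switch G b y a x = switch G a x b y := by
  ext u v
  simp only [switch]
  rw [show s(b, a) = s(a, b) from Sym2.eq_swap, show s(y, x) = s(x, y) from Sym2.eq_swap]
  grind

lemma switch_symm : switch G x a y b = switch G a x b y := by
  ext u v
  simp only [switch]
  rw [show s(x, a) = s(a, x) from Sym2.eq_swap, show s(y, b) = s(b, y) from Sym2.eq_swap]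
  grind

namespace Switchable

lemma ne_ay (h : Switchable G a x b y) : a ≠ y := by
  rintro rfl; exact h.not_ab h.adj_by.symm

lemma ne_xb (h : Switchable G a x b y) : x ≠ b := by
  rintro rfl; exact h.not_ab h.adj_ax

lemma comm (h : Switchable G a x b y) : Switchable G b y a x :=
  ⟨h.adj_by, h.adj_ax, h.ne_ab.symm, h.ne_xy.symm, fun h' => h.not_ab h'.symm,
    fun h' => h.not_xy h'.symm⟩

lemma symm (h : Switchable G a x b y) : Switchable G x a y b :=
  ⟨h.adj_ax.symm, h.adj_by.symm, h.ne_xy, h.ne_ab, h.not_xy, h.not_ab⟩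

lemma adj_iff (h : Switchable G a x b y) (u v : V) :
    (switch G a x b y).Adj u v ↔ (G.Adj u v ∧ s(u, v) ≠ s(a, x) ∧ s(u, v) ≠ s(b, y)) ∨
      s(u, v) = s(a, b) ∨ s(u, v) = s(x, y) := by
  have h1 := h.adj_ax
  have h2 := h.adj_by
  have h3 := h.not_ab
  have h4 := h.not_xy
  have h5 := h.ne_ab
  have h6 := h.ne_xy
  have h7 := h.ne_ay
  have h8 := h.ne_xb
  have h9 := h1.ne
  have h10 := h2.ne
  have h11 := h1.symm
  have h12 := h2.symm
  have h13 : ¬ G.Adj b a := fun h' => h3 h'.symm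
  have h14 : ¬ G.Adj y x := fun h' => h4 h'.symm
  simp only [switch, Sym2.eq_iff, Xor]
  by_cases huv : u = v
  · subst huv
    have := G.loopless.irrefl u
    grind
  grind

lemma switch_adj_ab (h : Switchable G a x b y) : (switch G a x b y).Adj a b := by
  rw [h.adj_iff]; simp

lemma switch_adj_xy (h : Switchable G a x b y) : (switch G a x b y).Adj x y := by
  rw [h.adj_iff]; simp

open scoped Classical in
lemma neighborFinset_left [Fintype V] (h : Switchable G a x b y) :
    (switch G a x b y).neighborFinset a = insert b ((G.neighborFinset a).erase x) := by
  ext v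
  have := h.ne_ab
  have := h.ne_ay
  have := h.adj_ax.ne
  simp only [SimpleGraph.mem_neighborFinset, h.adj_iff, Sym2.eq_iff, Finset.mem_insert,
    Finset.mem_erase]
  grind

open scoped Classical in
lemma degree_left [Fintype V] (h : Switchable G a x b y) :
    (switch G a x b y).degree a = G.degree a := by
  rw [← SimpleGraph.card_neighborFinset_eq_degree, h.neighborFinset_left,
    Finset.card_insert_of_notMem, Finset.card_erase_of_mem,
    SimpleGraph.card_neighborFinset_eq_degree]
  · have : 0 < G.degree a := (G.degree_pos_iff_exists_adj a).2 ⟨x, h.adj_ax⟩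
    omega
  · simpa using h.adj_ax
  · simp [h.not_ab]

open scoped Classical in
lemma degree_switch [Fintype V] (h : Switchable G a x b y) (v : V) :
    (switch G a x b y).degree v = G.degree v := by
  by_cases h1 : v = a
  · subst h1; exact h.degree_left
  by_cases h2 : v = b
  · subst h2; rw [← switch_comm]; exact h.comm.degree_left
  by_cases h3 : v = x
  · subst h3; rw [← switch_symm]; exact h.symm.degree_left
  by_cases h4 : v = y
  · subst h4; rw [← switch_symm, ← switch_comm]; exact h.symm.comm.degree_left
  rw [← SimpleGraph.card_neighborFinset_eq_degree, ← SimpleGraph.card_neighborFinset_eq_degree]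
  congr 1
  ext w
  simp only [SimpleGraph.mem_neighborFinset, h.adj_iff, Sym2.eq_iff]
  grind

end Switchable

/-- Double counting with weights: if every element of `P` has moves into `Q` of total weight at
least `F`, at most weight `B` of moves leads to any element of `Q`, and a move is determined by its
label and its result, then `|P| F ≤ |Q| B`. -/
lemma card_mul_le_card_mul_of_moves {α τ : Type*} (move : τ → α → α)
    (hmove : ∀ t, Function.Injective (move t)) (P Q : Finset α) (fwd bwd : α → Finset τ)
    (w : τ → ℝ) (F B : ℝ) (hw : ∀ t, 0 ≤ w t)
    (hQ : ∀ G ∈ P, ∀ t ∈ fwd G, move t G ∈ Q ∧ t ∈ bwd (move t G))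
    (hF : ∀ G ∈ P, F ≤ ∑ t ∈ fwd G, w t) (hB : ∀ G ∈ Q, ∑ t ∈ bwd G, w t ≤ B) :
    P.card * F ≤ Q.card * B := by
  classical
  calc P.card * F = ∑ G ∈ P, F := by simp
    _ ≤ ∑ G ∈ P, ∑ t ∈ fwd G, w t := Finset.sum_le_sum hF
    _ = ∑ s ∈ P.sigma fwd, w s.2 := by rw [Finset.sum_sigma]
    _ = ∑ s ∈ (P.sigma fwd).image (fun s => (⟨move s.2 s.1, s.2⟩ : (_ : α) × τ)), w s.2 := by
        rw [Finset.sum_image]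
        rintro ⟨G, t⟩ - ⟨G', t'⟩ - h
        simp only [Sigma.mk.injEq, heq_eq_eq] at h
        obtain ⟨h1, rfl⟩ := h
        rw [hmove t h1]
    _ ≤ ∑ s ∈ Q.sigma bwd, w s.2 := by
        apply Finset.sum_le_sum_of_subset_of_nonneg
        · intro s hs
          simp only [Finset.mem_image, Finset.mem_sigma] at hs
          obtain ⟨⟨G, t⟩, ⟨h1, h2⟩, rfl⟩ := hs
          simpa using hQ G h1 t h2
        · intro _ _ _; exact hw _
    _ = ∑ G ∈ Q, ∑ t ∈ bwd G, w t := by rw [Finset.sum_sigma]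
    _ ≤ ∑ G ∈ Q, B := Finset.sum_le_sum hB
    _ = Q.card * B := by simp

lemma pow_mul_card_le_of_chain {α : Type*} (P : ℕ → Finset α) (C : ℝ) (hC : 0 ≤ C) (t : ℕ)
    (h : ∀ i < t, C * (P i).card ≤ (P (i + 1)).card) : C ^ t * (P 0).card ≤ (P t).card := by
  induction t with
  | zero => simp
  | succ t ih =>
    calc C ^ (t + 1) * (P 0).card = C * (C ^ t * (P 0).card) := by ring
      _ ≤ C * (P t).card := mul_le_mul_of_nonneg_left (ih fun i hi => h i (by omega)) hC
      _ ≤ _ := h t (by omega)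

end Switch

/-! ### Edges between vertices of large and small degree -/

section Counting

open scoped Classical

variable {V : Type*}

/-- The number of neighbours of `a` in `L`. -/
noncomputable def nbrIn (G : SimpleGraph V) (L : Finset V) (a : V) : ℕ :=
  (L.filter (G.Adj a)).card

/-- The number of pairs in `A × B` which are adjacent in `G`. -/
noncomputable def edgeCount (G : SimpleGraph V) (A B : Finset V) : ℕ :=
  ((A ×ˢ B).filter fun e => G.Adj e.1 e.2).card

variable {G : SimpleGraph V} {d : V → ℕ} {a x b y : V} {A B L : Finset V}

lemma edgeCount_eq_sum : edgeCount G A B = ∑ a ∈ A, nbrIn G B a := by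
  simp only [edgeCount, nbrIn, Finset.card_filter, Finset.sum_product]

lemma edgeCount_comm : edgeCount G A B = edgeCount G B A := by
  simp only [edgeCount, Finset.card_filter, Finset.sum_product]
  rw [Finset.sum_comm]
  simp only [G.adj_comm]

lemma edgeCount_mono {A' B' : Finset V} (hA : A ⊆ A') (hB : B ⊆ B') :
    edgeCount G A B ≤ edgeCount G A' B' :=
  Finset.card_le_card (Finset.filter_subset_filter _ (Finset.product_subset_product hA hB))

lemma edgeCount_le_of_le {G H : SimpleGraph V} (h : H ≤ G) (A B : Finset V) :
    edgeCount H A B ≤ edgeCount G A B :=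
  Finset.card_le_card fun _ he =>
    Finset.mem_filter.2 ⟨(Finset.mem_filter.1 he).1, h (Finset.mem_filter.1 he).2⟩

/-- A switching increases the number of edges between `A` and `B` at most by the number of pairs of
`A × B` which are joined by one of the new edges. -/
lemma Switchable.edgeCount_switch_le (h : Switchable G a x b y) (s : Finset (V × V))
    (hs : ∀ u ∈ A, ∀ v ∈ B, s(u, v) = s(a, b) ∨ s(u, v) = s(x, y) → (u, v) ∈ s) :
    edgeCount (switch G a x b y) A B ≤ edgeCount G A B + s.card := by
  refine le_trans (Finset.card_le_card ?_) (Finset.card_union_le _ _)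
  rintro ⟨u, v⟩ huv
  simp only [Finset.mem_filter, Finset.mem_product, h.adj_iff] at huv
  simp only [Finset.mem_union, Finset.mem_filter, Finset.mem_product]
  obtain ⟨⟨hu, hv⟩, h1 | h1⟩ := huv
  · exact Or.inl ⟨⟨hu, hv⟩, h1.1⟩
  · exact Or.inr (hs u hu v hv h1)

variable [Fintype V]

/-- The graphs on `V` in which every vertex `v` has degree `d v`. -/
noncomputable def realizations (d : V → ℕ) : Finset (SimpleGraph V) :=
  Finset.univ.filter fun G => ∀ v, G.degree v = d v

lemma mem_realizations : G ∈ realizations d ↔ ∀ v, G.degree v = d v := by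
  simp [realizations]

lemma Switchable.mem_realizations (h : Switchable G a x b y) (hG : G ∈ realizations d) :
    switch G a x b y ∈ realizations d := by
  rw [DegreePercolation.mem_realizations] at hG ⊢
  intro v
  rw [h.degree_switch, hG]

lemma nbrIn_univ : nbrIn G Finset.univ a = G.degree a := by
  rw [nbrIn, ← SimpleGraph.card_neighborFinset_eq_degree, SimpleGraph.neighborFinset_eq_filter]

lemma nbrIn_le_degree : nbrIn G L a ≤ G.degree a := by
  rw [← nbrIn_univ]
  exact Finset.card_le_card (Finset.filter_subset_filter _ (Finset.subset_univ _))

lemma edgeCount_univ_right (hG : G ∈ realizations d) :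
    edgeCount G A Finset.univ = ∑ a ∈ A, d a := by
  rw [edgeCount_eq_sum]
  exact Finset.sum_congr rfl fun a _ => by rw [nbrIn_univ, mem_realizations.1 hG]

lemma edgeCount_add_compl :
    edgeCount G A B + edgeCount G A Bᶜ = edgeCount G A Finset.univ := by
  simp only [edgeCount_eq_sum, ← Finset.sum_add_distrib, nbrIn]
  refine Finset.sum_congr rfl fun a _ => ?_
  rw [← Finset.card_union_of_disjoint, ← Finset.filter_union, Finset.union_compl]
  exact Finset.disjoint_filter_filter disjoint_compl_right

/-- Typically many edges join the vertices of large degree to those of small degree: in a graph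
with few edges between `Y` and `L`, there are many ways to switch an edge at `W ⊆ Y` and an edge
from `L` to the complement of `Y`, because a vertex of `W` has twice the degree of a vertex outside
`Y` and hence many neighbours outside the neighbourhood of the latter. -/
lemma two_pow_mul_card_few_edges_le (k l D t : ℕ) (ε z : ℝ) (Y W L : Finset V) (hk : 1 ≤ k)
    (hε0 : 0 ≤ ε) (hε : ε ≤ 1) (hl : l = 2 * k) (hD : 1 ≤ D)
    (hsum : ∑ v, d v ≤ k * Fintype.card V)
    (hL1 : ∀ v ∈ L, 1 ≤ d v) (hLl : ∀ v ∈ L, d v ≤ l) (hL : Fintype.card V ≤ 2 * L.card)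
    (hLY : Disjoint L Y) (hWY : W ⊆ Y) (hWD : ∀ v ∈ W, 2 * D ≤ d v) (hYD : ∀ v ∉ Y, d v < D)
    (hW : ε * Fintype.card V ≤ ∑ v ∈ W, (d v : ℝ))
    (hz : 24 * k * (z + 2 * t) ≤ ε * Fintype.card V) :
    2 ^ t * (((realizations d).filter fun G => (edgeCount G Y L : ℝ) ≤ z).card : ℝ) ≤
      (realizations d).card := by
  set n : ℝ := (Fintype.card V : ℝ) with hn
  have hn0 : 0 ≤ n := by positivity
  have hk' : (1 : ℝ) ≤ k := by exact_mod_cast hk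
  -- each switching creates at most two edges between `Y` and `L`, so the threshold grows by two
  set P : ℕ → Finset (SimpleGraph V) := fun i =>
    (realizations d).filter fun G => (edgeCount G Y L : ℝ) ≤ z + 2 * i with hP
  have key := pow_mul_card_le_of_chain P 2 (by norm_num) t ?_
  · refine le_trans ?_ (key.trans (by exact_mod_cast Finset.card_filter_le _ _))
    simp [hP]
  intro i hi
  have hit : ((i + 1 : ℕ) : ℝ) ≤ t := by exact_mod_cast hi
  push_cast at hit
  have hzi : 24 * k * (z + 2 * (i + 1)) ≤ ε * n := by
    refine le_trans ?_ hz
    gcongr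
  rcases hn0.eq_or_lt with hn00 | hnpos
  · have : Fintype.card V = 0 := by rw [hn] at hn00; exact_mod_cast hn00.symm
    have := Fintype.card_eq_zero_iff.1 this
    have hz' : z + 2 * (i + 1) ≤ 0 := by
      rw [← hn00, mul_zero] at hzi
      nlinarith
    have : (P i) = ∅ := by
      simp only [hP, Finset.filter_eq_empty_iff]
      intro G _ h
      have : (0 : ℝ) ≤ edgeCount G Y L := by positivity
      linarith
    simp [this]
  have hdc := card_mul_le_card_mul_of_moves
    (fun (s : (V × V) × (V × V)) (G : SimpleGraph V) => switch G s.2.1 s.2.2 s.1.1 s.1.2)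
    (fun s => switch_injective) (P i) (P (i + 1))
    (fun G => (((L ×ˢ Yᶜ).filter fun e => G.Adj e.1 e.2) ×ˢ (W ×ˢ Finset.univ)).filter
      fun s => Switchable G s.2.1 s.2.2 s.1.1 s.1.2)
    (fun G => (Finset.univ : Finset ((V × V) × (V × V))).filter
      fun s => (s.2.1 ∈ Y ∧ s.1.1 ∈ L ∧ G.Adj s.2.1 s.1.1) ∧ G.Adj s.2.2 s.1.2)
    (fun _ => 1) (ε * n ^ 2 / 8) ((z + 2 * (i + 1)) * (k * n)) (by simp) ?_ ?_ ?_
  · have h3 : 0 ≤ (P (i + 1)).card * n := by positivity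
    rcases hε0.eq_or_lt with rfl | hεpos
    · have hz' : z + 2 * (i + 1) ≤ 0 := by
        rw [zero_mul] at hzi
        nlinarith
      have : (P i) = ∅ := by
        simp only [hP, Finset.filter_eq_empty_iff]
        intro G _ h
        have : (0 : ℝ) ≤ edgeCount G Y L := by positivity
        linarith
      simp [this]
    · have h4 : (P (i + 1)).card * ((z + 2 * (i + 1)) * (k * n)) ≤
          (P (i + 1)).card * (ε * n ^ 2 / 24) := by
        gcongr
        nlinarith
      have h5 : 0 < ε * n ^ 2 := by positivity
      nlinarith
  · -- a switching creates at most two new pairs between `Y` and `L`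
    rintro G hG ⟨⟨b, y⟩, ⟨a, x⟩⟩ hs
    simp only [Finset.mem_filter, Finset.mem_product, Finset.mem_compl, Finset.mem_univ, and_true,
      hP] at hs hG
    obtain ⟨⟨⟨⟨hb, hy⟩, hby⟩, ha⟩, hsw⟩ := hs
    refine ⟨Finset.mem_filter.2 ⟨hsw.mem_realizations hG.1, ?_⟩, Finset.mem_filter.2
      ⟨Finset.mem_univ _, ⟨hWY ha, hb, hsw.switch_adj_ab⟩, hsw.switch_adj_xy⟩⟩
    have h1 := hsw.edgeCount_switch_le (A := Y) (B := L) {(a, b), (x, y)} ?_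
    · have h2 : (edgeCount (switch G a x b y) Y L : ℝ) ≤ edgeCount G Y L + 2 := by
        exact_mod_cast h1.trans (Nat.add_le_add_left Finset.card_le_two _)
      push_cast
      linarith [hG.2]
    · intro u hu v hv huv
      have := Finset.disjoint_left.1 hLY hb
      simp only [Sym2.eq_iff, Finset.mem_insert, Finset.mem_singleton, Prod.mk.injEq] at huv ⊢
      grind
  · -- edges `by` with `b ∈ L`, `y ∉ Y`, and then edges `ax` with `a ∈ W` not adjacent to `b`
    intro G hG
    simp only [hP, Finset.mem_filter] at hG
    obtain ⟨hGd, hGe⟩ := hG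
    have hdeg := mem_realizations.1 hGd
    set S := (L ×ˢ Yᶜ).filter fun e => G.Adj e.1 e.2 with hS
    have hScard : n / 3 ≤ S.card := by
      have h1 := edgeCount_add_compl (G := G) (A := L) (B := Y)
      rw [edgeCount_univ_right hGd] at h1
      have h2 : L.card ≤ ∑ v ∈ L, d v := by
        simpa using Finset.sum_le_sum hL1
      have h3 : edgeCount G L Yᶜ = S.card := rfl
      have h4 : (edgeCount G L Y : ℝ) ≤ z + 2 * i := by rw [edgeCount_comm]; exact hGe
      have h5 : (L.card : ℝ) ≤ edgeCount G L Y + S.card := by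
        rw [← h3]; exact_mod_cast h2.trans h1.ge
      have h6 : n ≤ 2 * L.card := by rw [hn]; exact_mod_cast hL
      nlinarith
    have hinner : ∀ b y, (b, y) ∈ S → ∀ a ∈ W,
        (d a : ℝ) / 2 - n / 2 * (if G.Adj b a then 1 else 0) ≤
          ((Finset.univ.filter fun x => Switchable G a x b y).card : ℝ) := by
      intro b y hby a ha
      simp only [hS, Finset.mem_filter, Finset.mem_product, Finset.mem_compl] at hby
      obtain ⟨⟨hb, hy⟩, hby⟩ := hby
      split_ifs with hab
      · have : (d a : ℝ) ≤ n := by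
          rw [hn, ← hdeg a]; exact_mod_cast (G.degree_lt_card_verts a).le
        have : (0 : ℝ) ≤ ((Finset.univ.filter fun x => Switchable G a x b y).card : ℝ) := by
          positivity
        linarith
      · have hsub : (G.neighborFinset a) \ (insert y (G.neighborFinset y)) ⊆
            Finset.univ.filter fun x => Switchable G a x b y := by
          intro x hx
          simp only [Finset.mem_sdiff, SimpleGraph.mem_neighborFinset, Finset.mem_insert, not_or,
            Finset.mem_filter, Finset.mem_univ, true_and] at hx ⊢
          refine ⟨hx.1, hby, ?_, hx.2.1, fun h => hab h.symm, fun h => hx.2.2 h.symm⟩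
          rintro rfl
          exact Finset.disjoint_left.1 hLY hb (hWY ha)
        have h1 := (Finset.le_card_sdiff (insert y (G.neighborFinset y)) (G.neighborFinset a)).trans
          (Finset.card_le_card hsub)
        have h2 := Finset.card_insert_le y (G.neighborFinset y)
        rw [SimpleGraph.card_neighborFinset_eq_degree, hdeg] at h1 h2
        have h3 := hYD y hy
        have h4 := hWD a ha
        have h5 : d a ≤ 2 * (Finset.univ.filter fun x => Switchable G a x b y).card := by omega
        have h6 : (d a : ℝ) ≤ 2 * (Finset.univ.filter fun x => Switchable G a x b y).card := by
          exact_mod_cast h5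
        linarith
    have hadj : ∑ e ∈ S, ∑ a ∈ W, (if G.Adj e.1 a then (1 : ℝ) else 0) ≤ l * (z + 2 * i) := by
      have h1 : ∀ e : V × V, ∑ a ∈ W, (if G.Adj e.1 a then (1 : ℝ) else 0) = nbrIn G W e.1 := by
        intro e; simp [nbrIn]
      simp only [h1]
      rw [hS, Finset.sum_filter, Finset.sum_product]
      calc _ = ∑ b ∈ L, (nbrIn G Yᶜ b : ℝ) * nbrIn G W b := by
            refine Finset.sum_congr rfl fun b _ => ?_
            rw [← Finset.sum_filter]; simp [nbrIn]
        _ ≤ ∑ b ∈ L, (l : ℝ) * nbrIn G W b := by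
            refine Finset.sum_le_sum fun b hb => ?_
            gcongr
            exact nbrIn_le_degree.trans ((hdeg b).trans_le (hLl b hb))
        _ = l * edgeCount G W L := by
            rw [← Finset.mul_sum, edgeCount_comm, edgeCount_eq_sum]; push_cast; rfl
        _ ≤ l * edgeCount G Y L := by
            gcongr
            exact edgeCount_mono hWY subset_rfl
        _ ≤ _ := by gcongr
    calc ε * n ^ 2 / 8 ≤ n / 3 * (ε * n / 2) - n / 2 * (l * (z + 2 * i)) := by
          subst hl; push_cast; nlinarith
      _ ≤ S.card * ((∑ v ∈ W, (d v : ℝ)) / 2) -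
            n / 2 * ∑ e ∈ S, ∑ a ∈ W, (if G.Adj e.1 a then (1 : ℝ) else 0) := by
          gcongr
      _ = ∑ e ∈ S, ∑ a ∈ W, ((d a : ℝ) / 2 - n / 2 * (if G.Adj e.1 a then 1 else 0)) := by
          simp only [Finset.sum_sub_distrib, Finset.sum_const, nsmul_eq_mul, Finset.mul_sum,
            Finset.sum_div]
      _ ≤ ∑ e ∈ S, ∑ a ∈ W, ((Finset.univ.filter fun x => Switchable G a x e.1 e.2).card : ℝ) :=
          Finset.sum_le_sum fun e he => Finset.sum_le_sum fun a ha => hinner e.1 e.2 he a ha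
      _ = _ := by
          conv_rhs => rw [Finset.sum_filter, Finset.sum_product]
          refine Finset.sum_congr rfl fun e _ => ?_
          rw [Finset.sum_product]
          refine Finset.sum_congr rfl fun a _ => ?_
          simp
  · intro G hG
    simp only [hP, Finset.mem_filter] at hG
    obtain ⟨hGd, hGe⟩ := hG
    rw [Nat.cast_add, Nat.cast_one] at hGe
    calc _ = ((edgeCount G Y L * edgeCount G Finset.univ Finset.univ : ℕ) : ℝ) := by
          rw [Finset.sum_const, nsmul_eq_mul, mul_one, edgeCount, edgeCount, ← Finset.card_product]
          congr 1
          refine Finset.card_bij' (fun s _ => ((s.2.1, s.1.1), (s.2.2, s.1.2)))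
            (fun s _ => ((s.1.2, s.2.2), (s.1.1, s.2.1))) ?_ ?_ ?_ ?_ <;> simp <;> tauto
      _ ≤ _ := by
          rw [edgeCount_univ_right hGd]
          have h1 : ((∑ v, d v : ℕ) : ℝ) ≤ k * n := by rw [hn]; exact_mod_cast hsum
          have h2 : (0 : ℝ) ≤ edgeCount G Y L := by positivity
          rw [Nat.cast_mul]
          exact mul_le_mul hGe h1 (by positivity) (h2.trans hGe)

end Counting

/-! ### Edges between two sets of vertices of large degree -/

section CrossEdges

open scoped Classical

variable {V : Type*} [Fintype V] {G : SimpleGraph V} {d : V → ℕ} {a x b y : V} {A B L : Finset V}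

/-- Since vertices of `L` have few neighbours, most pairs of a neighbour of `a` in `L` and a
neighbour of `b` in `L` are distinct and non-adjacent. -/
lemma nbrIn_mul_nbrIn_le (l : ℕ) (hl : ∀ v ∈ L, G.degree v ≤ l) (hab : a ≠ b)
    (hadj : ¬ G.Adj a b) (hb : 2 * (l + 1) ≤ nbrIn G L b) :
    nbrIn G L a * nbrIn G L b ≤
      2 * ((L ×ˢ L).filter fun e => Switchable G a e.1 b e.2).card := by
  have h1 : ∀ x ∈ L.filter (G.Adj a),
      nbrIn G L b ≤ 2 * (L.filter fun y => Switchable G a x b y).card := by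
    intro x hx
    rw [Finset.mem_filter] at hx
    have hsub : (L.filter (G.Adj b)) \ (insert x (G.neighborFinset x)) ⊆
        L.filter fun y => Switchable G a x b y := by
      intro y hy
      simp only [Finset.mem_sdiff, Finset.mem_filter, SimpleGraph.mem_neighborFinset,
        Finset.mem_insert, not_or] at hy ⊢
      exact ⟨hy.1.1, hx.2, hy.1.2, hab, fun h => hy.2.1 h.symm, hadj, hy.2.2⟩
    have h2 := (Finset.le_card_sdiff (insert x (G.neighborFinset x)) (L.filter (G.Adj b))).trans
      (Finset.card_le_card hsub)
    have h3 := Finset.card_insert_le x (G.neighborFinset x)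
    rw [SimpleGraph.card_neighborFinset_eq_degree] at h3
    have h4 := hl x hx.1
    rw [← nbrIn] at h2
    omega
  calc nbrIn G L a * nbrIn G L b = ∑ x ∈ L.filter (G.Adj a), nbrIn G L b := by simp [nbrIn]
    _ ≤ ∑ x ∈ L.filter (G.Adj a), 2 * (L.filter fun y => Switchable G a x b y).card :=
        Finset.sum_le_sum h1
    _ ≤ ∑ x ∈ L, 2 * (L.filter fun y => Switchable G a x b y).card :=
        Finset.sum_le_sum_of_subset (Finset.filter_subset _ _)
    _ = _ := by
        rw [← Finset.mul_sum, Finset.card_filter, Finset.sum_product]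
        simp

/-- The total weight of the switchings creating an edge between `A` and `B`, when `G` has few such
edges and few vertices of `A ∪ B` have lost their share of neighbours in `L`. The edge `ab` has the
weight `min 1 (kn / (d a d b))`, of the order of the probability of not having `ab` as an edge, so
that pairs of vertices of huge degree, which may all be adjacent already, do not dominate. -/
lemma le_sum_weight_switchable (k l D q T : ℕ) (c M Δ r : ℝ) (hq : 1 ≤ q)
    (hc : 0 < c) (hM : 0 < M) (hn0 : 0 < Fintype.card V)
    (hGd : G ∈ realizations d) (hLl : ∀ v ∈ L, d v ≤ l) (hAB : Disjoint A B)
    (hD : ∀ v ∈ A ∪ B, D ≤ d v) (hΔ : ∀ v ∈ A ∪ B, (d v : ℝ) ≤ Δ)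
    (hA : c * Fintype.card V ≤ ∑ v ∈ A, (d v : ℝ)) (hB : c * Fintype.card V ≤ ∑ v ∈ B, (d v : ℝ))
    (hrAB : r ≤ A.card + B.card) (hDl : 4 * q * (l + 1) ≤ D)
    (hT : 8 * q * T ≤ c * Fintype.card V) (hTr : 8 * q * T ≤ D * r)
    (hMD : M ≤ D) (hMΔ : M * Δ ≤ k * Fintype.card V) (hMT : 272 * q ^ 2 * T * k ≤ r * c * M)
    (hGe : edgeCount G A B ≤ 2 * T) (hGs : ∑ v ∈ A ∪ B, (d v - q * nbrIn G L v) ≤ 2 * q * T) :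
    4 * T * (k * Fintype.card V) ≤ ∑ t ∈ ((A ×ˢ B) ×ˢ (L ×ˢ L)).filter
      (fun s => Switchable G s.1.1 s.2.1 s.1.2 s.2.2),
        min 1 (k * Fintype.card V / (d t.1.1 * d t.1.2 : ℝ)) := by
  set n : ℝ := (Fintype.card V : ℝ) with hn
  have hnpos : 0 < n := by rw [hn]; exact_mod_cast hn0
  have hq' : (1 : ℝ) ≤ q := by exact_mod_cast hq
  set m : ℝ := k * n with hm
  have hm0 : 0 ≤ m := by positivity
  have hDpos : 1 ≤ D := by
    have : 0 < 4 * q * (l + 1) := by positivity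
    omega
  have hdeg := mem_realizations.1 hGd
  -- the vertices which have kept at least half of their share of neighbours in `L`
  set A' := A.filter fun v => d v ≤ 2 * q * nbrIn G L v with hA'
  set B' := B.filter fun v => d v ≤ 2 * q * nbrIn G L v with hB'
  have hbad : ∑ v ∈ (A ∪ B).filter (fun v => ¬ d v ≤ 2 * q * nbrIn G L v), (d v : ℝ) ≤
      4 * q * T := by
    have h1 : ∑ v ∈ (A ∪ B).filter (fun v => ¬ d v ≤ 2 * q * nbrIn G L v), d v ≤
        2 * ∑ v ∈ A ∪ B, (d v - q * nbrIn G L v) := by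
      rw [Finset.mul_sum]
      refine le_trans (Finset.sum_le_sum fun v hv => ?_)
        (Finset.sum_le_sum_of_subset (Finset.filter_subset _ _))
      have := (Finset.mem_filter.1 hv).2
      rw [mul_assoc] at this
      omega
    have h2 : ((∑ v ∈ (A ∪ B).filter (fun v => ¬ d v ≤ 2 * q * nbrIn G L v), d v : ℕ) : ℝ) ≤
        ((2 * (2 * q * T) : ℕ) : ℝ) := by
      exact_mod_cast h1.trans (Nat.mul_le_mul_left 2 hGs)
    push_cast at h2
    linarith
  have hsplit : ∀ C ⊆ A ∪ B, ∀ f : V → ℝ, (∀ v, 0 ≤ f v) → ∑ v ∈ C, f v ≤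
      ∑ v ∈ C.filter (fun v => d v ≤ 2 * q * nbrIn G L v), f v +
      ∑ v ∈ (A ∪ B).filter (fun v => ¬ d v ≤ 2 * q * nbrIn G L v), f v := by
    intro C hC f hf
    rw [← Finset.sum_filter_add_sum_filter_not C (fun v => d v ≤ 2 * q * nbrIn G L v)]
    gcongr
    exact fun v _ _ => hf v
  have hmass : ∀ C ⊆ A ∪ B, c * n ≤ ∑ v ∈ C, (d v : ℝ) → c * n / 2 ≤
      ∑ v ∈ C.filter (fun v => d v ≤ 2 * q * nbrIn G L v), (d v : ℝ) := by
    intro C hC hCd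
    have := hsplit C hC (fun v => d v) (fun v => by positivity)
    linarith
  have hA'm := hmass A Finset.subset_union_left hA
  have hB'm := hmass B Finset.subset_union_right hB
  have hcard : r / 2 ≤ A'.card + B'.card := by
    have h1 : D * (((A ∪ B).filter (fun v => ¬ d v ≤ 2 * q * nbrIn G L v)).card : ℝ) ≤
        4 * q * T := by
      refine le_trans ?_ hbad
      rw [mul_comm, ← nsmul_eq_mul]
      refine Finset.card_nsmul_le_sum _ _ _ fun v hv => ?_
      exact_mod_cast hD v (Finset.mem_filter.1 hv).1
    have h2 : (A.card : ℝ) + B.card ≤ A'.card + B'.card +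
        ((A ∪ B).filter (fun v => ¬ d v ≤ 2 * q * nbrIn G L v)).card := by
      have h3 : (A ∪ B).card = A.card + B.card := Finset.card_union_of_disjoint hAB
      have h4 := Finset.card_filter_add_card_filter_not (s := A ∪ B)
        (fun v => d v ≤ 2 * q * nbrIn G L v)
      have h5 : ((A ∪ B).filter fun v => d v ≤ 2 * q * nbrIn G L v).card ≤
          A'.card + B'.card := by
        rw [Finset.filter_union]; exact Finset.card_union_le _ _
      have h6 : A.card + B.card ≤ A'.card + B'.card +
        ((A ∪ B).filter (fun v => ¬ d v ≤ 2 * q * nbrIn G L v)).card := by omega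
      exact_mod_cast h6
    have hD' : (0 : ℝ) < D := by exact_mod_cast hDpos
    have h3 : D * (((A ∪ B).filter (fun v => ¬ d v ≤ 2 * q * nbrIn G L v)).card : ℝ) ≤
        D * (r / 2) := by linarith
    have h4 := le_of_mul_le_mul_left h3 hD'
    linarith
  have hminle : ∀ v ∈ A ∪ B, ∀ u ∈ A ∪ B, M * d u ≤ min ((d v : ℝ) * d u) m := by
    intro v hv u hu
    refine le_min ?_ ?_
    · gcongr
      exact hMD.trans (by exact_mod_cast hD v hv)
    · exact (mul_le_mul_of_nonneg_left (hΔ u hu) hM.le).trans hMΔ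
  have hpairs : r / 4 * (M * (c * n / 2)) ≤
      ∑ v ∈ A', ∑ u ∈ B', min ((d v : ℝ) * d u) m := by
    have hA'sub : A' ⊆ A ∪ B := (Finset.filter_subset _ _).trans Finset.subset_union_left
    have hB'sub : B' ⊆ A ∪ B := (Finset.filter_subset _ _).trans Finset.subset_union_right
    rcases le_total A'.card B'.card with h | h
    · have h' : (A'.card : ℝ) ≤ B'.card := by exact_mod_cast h
      rw [Finset.sum_comm]
      calc _ ≤ B'.card * (M * (c * n / 2)) := by gcongr; linarith
        _ = ∑ u ∈ B', M * (c * n / 2) := by simp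
        _ ≤ _ := Finset.sum_le_sum fun u hu => by
            calc _ ≤ M * ∑ v ∈ A', (d v : ℝ) := by gcongr
              _ = ∑ v ∈ A', M * (d v : ℝ) := by rw [Finset.mul_sum]
              _ ≤ _ := Finset.sum_le_sum fun v hv => by
                rw [mul_comm (d v : ℝ)]
                exact hminle u (hB'sub hu) v (hA'sub hv)
    · have h' : (B'.card : ℝ) ≤ A'.card := by exact_mod_cast h
      calc _ ≤ A'.card * (M * (c * n / 2)) := by gcongr; linarith
        _ = ∑ u ∈ A', M * (c * n / 2) := by simp
        _ ≤ _ := Finset.sum_le_sum fun u hu => by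
            calc _ ≤ M * ∑ v ∈ B', (d v : ℝ) := by gcongr
              _ = ∑ v ∈ B', M * (d v : ℝ) := by rw [Finset.mul_sum]
              _ ≤ _ := Finset.sum_le_sum fun v hv => hminle u (hA'sub hu) v (hB'sub hv)
  have hinner : ∀ a ∈ A', ∀ b ∈ B',
      (min ((d a : ℝ) * d b) m - m * (if G.Adj a b then 1 else 0)) / (8 * q ^ 2) ≤
        min 1 (m / (d a * d b)) *
          ((L ×ˢ L).filter fun e => Switchable G a e.1 b e.2).card := by
    intro a ha b hb
    rw [Finset.mem_filter] at ha hb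
    split_ifs with hab
    · refine le_trans ?_ (by positivity : (0 : ℝ) ≤ _)
      refine div_nonpos_of_nonpos_of_nonneg ?_ (by positivity)
      have := min_le_right ((d a : ℝ) * d b) m
      linarith
    · have hDa := hD a (Finset.mem_union_left _ ha.1)
      have hDb := hD b (Finset.mem_union_right _ hb.1)
      have hne : a ≠ b := by rintro rfl; exact Finset.disjoint_left.1 hAB ha.1 hb.1
      have hb2 : 2 * (l + 1) ≤ nbrIn G L b := by
        have h1 : 2 * q * (2 * (l + 1)) ≤ 2 * q * nbrIn G L b := by
          calc _ = 4 * q * (l + 1) := by ring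
            _ ≤ _ := hDl.trans (hDb.trans hb.2)
        exact Nat.le_of_mul_le_mul_left h1 (by positivity)
      have h1 := nbrIn_mul_nbrIn_le l (fun v hv => (hdeg v).trans_le (hLl v hv)) hne hab hb2
      have h2 : d a * d b ≤ 8 * q ^ 2 *
          ((L ×ˢ L).filter fun e => Switchable G a e.1 b e.2).card := by
        calc d a * d b ≤ (2 * q * nbrIn G L a) * (2 * q * nbrIn G L b) :=
              Nat.mul_le_mul ha.2 hb.2
          _ = 4 * q ^ 2 * (nbrIn G L a * nbrIn G L b) := by ring
          _ ≤ 4 * q ^ 2 * (2 * ((L ×ˢ L).filter fun e => Switchable G a e.1 b e.2).card) :=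
              Nat.mul_le_mul_left _ h1
          _ = _ := by ring
      have h3 : (d a : ℝ) * d b ≤ 8 * q ^ 2 *
          ((L ×ˢ L).filter fun e => Switchable G a e.1 b e.2).card := by exact_mod_cast h2
      have hda : (0 : ℝ) < d a := by exact_mod_cast lt_of_lt_of_le hDpos hDa
      have hdb : (0 : ℝ) < d b := by exact_mod_cast lt_of_lt_of_le hDpos hDb
      rw [div_le_iff₀ (by positivity), mul_zero, sub_zero]
      have h4 : min ((d a : ℝ) * d b) m = min 1 (m / (d a * d b)) * (d a * d b) := by
        rw [min_mul_of_nonneg _ _ (by positivity), one_mul, div_mul_cancel₀ _ (by positivity)]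
      rw [h4]
      calc _ ≤ min 1 (m / (d a * d b)) * (8 * q ^ 2 *
          ((L ×ˢ L).filter fun e => Switchable G a e.1 b e.2).card) := by gcongr
        _ = _ := by ring
  have hadj : ∑ a ∈ A', ∑ b ∈ B', (if G.Adj a b then (1 : ℝ) else 0) ≤ 2 * T := by
    have h1 : ∑ a ∈ A', ∑ b ∈ B', (if G.Adj a b then (1 : ℝ) else 0) = edgeCount G A' B' := by
      rw [edgeCount_eq_sum]; simp [nbrIn]
    have h2 : edgeCount G A' B' ≤ edgeCount G A B :=
      edgeCount_mono (Finset.filter_subset _ _) (Finset.filter_subset _ _)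
    have h3 : edgeCount G A' B' ≤ 2 * T := h2.trans hGe
    rw [h1]
    exact_mod_cast h3
  calc 4 * T * (k * n) ≤ (r / 4 * (M * (c * n / 2)) - m * (2 * T)) / (8 * q ^ 2) := by
        rw [le_div_iff₀ (by positivity), hm]
        have h1 := mul_le_mul_of_nonneg_right hMT hnpos.le
        have h2 : (0 : ℝ) ≤ T * (k * n) := by positivity
        have h3 : (1 : ℝ) ≤ q ^ 2 := by nlinarith
        have h4 := mul_le_mul_of_nonneg_left h3 h2
        linarith
    _ ≤ (∑ v ∈ A', ∑ u ∈ B', min ((d v : ℝ) * d u) m -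
          m * ∑ a ∈ A', ∑ b ∈ B', (if G.Adj a b then (1 : ℝ) else 0)) / (8 * q ^ 2) := by
        gcongr
    _ = ∑ a ∈ A', ∑ b ∈ B',
          (min ((d a : ℝ) * d b) m - m * (if G.Adj a b then 1 else 0)) / (8 * q ^ 2) := by
        simp only [Finset.mul_sum, ← Finset.sum_sub_distrib, Finset.sum_div]
    _ ≤ ∑ a ∈ A', ∑ b ∈ B', min 1 (m / (d a * d b)) *
          ((L ×ˢ L).filter fun e => Switchable G a e.1 b e.2).card :=
        Finset.sum_le_sum fun a ha => Finset.sum_le_sum fun b hb => hinner a ha b hb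
    _ ≤ ∑ a ∈ A, ∑ b ∈ B, min 1 (m / (d a * d b)) *
          ((L ×ˢ L).filter fun e => Switchable G a e.1 b e.2).card := by
        rw [← Finset.sum_product', ← Finset.sum_product']
        refine Finset.sum_le_sum_of_subset_of_nonneg (Finset.product_subset_product
          (Finset.filter_subset _ _) (Finset.filter_subset _ _)) fun _ _ _ => by positivity
    _ = _ := by
        conv_rhs => rw [Finset.sum_filter, Finset.sum_product, Finset.sum_product]
        refine Finset.sum_congr rfl fun a _ => Finset.sum_congr rfl fun b _ => ?_
        rw [← Finset.sum_filter]
        dsimp only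
        rw [Finset.sum_const, nsmul_eq_mul, mul_comm]

/-- If `A` and `B` have large total degree, and each of their vertices has a fair share of its
neighbours in `L`, then typically many edges join `A` and `B`. An edge from `a ∈ A` to `L` and an
edge from `b ∈ B` to `L` are switched, creating the edge `ab`. -/
lemma two_pow_mul_card_few_cross_edges_le (k l D q T : ℕ) (c M Δ r : ℝ) (hk : 1 ≤ k) (hq : 1 ≤ q)
    (hc : 0 < c) (hM : 0 < M)
    (hsum : ∑ v, d v ≤ k * Fintype.card V) (hn0 : 0 < Fintype.card V)
    (hLl : ∀ v ∈ L, d v ≤ l) (hAB : Disjoint A B) (hLA : Disjoint L A) (hLB : Disjoint L B)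
    (hD : ∀ v ∈ A ∪ B, D ≤ d v) (hΔ : ∀ v ∈ A ∪ B, (d v : ℝ) ≤ Δ)
    (hA : c * Fintype.card V ≤ ∑ v ∈ A, (d v : ℝ)) (hB : c * Fintype.card V ≤ ∑ v ∈ B, (d v : ℝ))
    (hrAB : r ≤ A.card + B.card) (hDl : 4 * q * (l + 1) ≤ D)
    (hT : 8 * q * T ≤ c * Fintype.card V) (hTr : 8 * q * T ≤ D * r)
    (hMD : M ≤ D) (hMΔ : M * Δ ≤ k * Fintype.card V) (hMT : 272 * q ^ 2 * T * k ≤ r * c * M) :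
    2 ^ T * (((realizations d).filter fun G => edgeCount G A B < T ∧
      ∀ v ∈ A ∪ B, d v ≤ q * nbrIn G L v).card : ℝ) ≤ (realizations d).card := by
  set n : ℝ := (Fintype.card V : ℝ) with hn
  have hnpos : 0 < n := by rw [hn]; exact_mod_cast hn0
  have hk' : (1 : ℝ) ≤ k := by exact_mod_cast hk
  have hq' : (1 : ℝ) ≤ q := by exact_mod_cast hq
  set m : ℝ := k * n with hm
  have hmpos : 0 < m := by positivity
  have hDpos : 1 ≤ D := by
    have : 0 < 4 * q * (l + 1) := by positivity
    omega
  -- the truncated differences `d v - q * nbrIn G L v` measure how far the share in `L` has dropped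
  set P : ℕ → Finset (SimpleGraph V) := fun i => (realizations d).filter fun G =>
    edgeCount G A B < T + i ∧ ∑ v ∈ A ∪ B, (d v - q * nbrIn G L v) ≤ 2 * q * i with hP
  have key := pow_mul_card_le_of_chain P 2 (by norm_num) T ?_
  · refine le_trans ?_ (key.trans (by exact_mod_cast Finset.card_filter_le _ _))
    gcongr
    intro G hG
    simp only [hP, Finset.mem_filter] at hG ⊢
    refine ⟨hG.1, by simpa using hG.2.1, le_of_eq ?_⟩
    rw [mul_zero]
    exact Finset.sum_eq_zero fun v hv => Nat.sub_eq_zero_of_le (hG.2.2 v hv)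
  intro i hi
  set w : (V × V) × (V × V) → ℝ := fun s => min 1 (m / (d s.1.1 * d s.1.2)) with hw
  have hdc := card_mul_le_card_mul_of_moves
    (fun (s : (V × V) × (V × V)) (G : SimpleGraph V) => switch G s.1.1 s.2.1 s.1.2 s.2.2)
    (fun s => switch_injective) (P i) (P (i + 1))
    (fun G => ((A ×ˢ B) ×ˢ (L ×ˢ L)).filter
      fun s => Switchable G s.1.1 s.2.1 s.1.2 s.2.2)
    (fun G => (((A ×ˢ B).filter fun e => G.Adj e.1 e.2) ×ˢ
      ((Finset.univ ×ˢ Finset.univ).filter fun e => G.Adj e.1 e.2)))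
    w (4 * T * (k * n)) (2 * T * m) (fun s => by positivity) ?_ ?_ ?_
  · have hT0 : (0 : ℝ) < T := by exact_mod_cast Nat.lt_of_le_of_lt (Nat.zero_le _) hi
    have : 0 < 2 * T * m := by positivity
    refine le_of_mul_le_mul_right ?_ this
    calc _ = (P i).card * (4 * T * (k * n)) := by rw [hm]; ring
      _ ≤ _ := hdc
  · -- a switching creates one edge between `A` and `B` and destroys one edge to `L` at `a` and `b`
    rintro G hG ⟨⟨a, b⟩, ⟨x, y⟩⟩ hs
    simp only [Finset.mem_filter, Finset.mem_product, hP] at hs hG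
    obtain ⟨⟨⟨ha, hb⟩, hx, hy⟩, hsw⟩ := hs
    have hxA := Finset.disjoint_left.1 hLA hx
    have hyA := Finset.disjoint_left.1 hLA hy
    have hxB := Finset.disjoint_left.1 hLB hx
    have hyB := Finset.disjoint_left.1 hLB hy
    have hbA := Finset.disjoint_right.1 hAB hb
    refine ⟨Finset.mem_filter.2 ⟨hsw.mem_realizations hG.1, ?_, ?_⟩, Finset.mem_product.2
      ⟨Finset.mem_filter.2 ⟨Finset.mem_product.2 ⟨ha, hb⟩, hsw.switch_adj_ab⟩,
      Finset.mem_filter.2 ⟨by simp, hsw.switch_adj_xy⟩⟩⟩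
    · have h1 := hsw.edgeCount_switch_le (A := A) (B := B) {(a, b)} ?_
      · rw [Finset.card_singleton] at h1
        have := hG.2.1
        change edgeCount (switch G a x b y) A B < _
        omega
      · intro u hu v hv huv
        simp only [Sym2.eq_iff, Finset.mem_singleton, Prod.mk.injEq] at huv ⊢
        grind
    · change ∑ v ∈ A ∪ B, (d v - q * nbrIn (switch G a x b y) L v) ≤ _
      have h1 : ∀ v ∈ A ∪ B, d v - q * nbrIn (switch G a x b y) L v ≤
          (d v - q * nbrIn G L v) + if v ∈ ({a, b} : Finset V) then q else 0 := by
        intro v hv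
        have hvx : v ≠ x := by rintro rfl; simp [hxA, hxB] at hv
        have hvy : v ≠ y := by rintro rfl; simp [hyA, hyB] at hv
        have hax : a ≠ x := by rintro rfl; exact hxA ha
        have hby : b ≠ y := by rintro rfl; exact hyB hb
        have hab := hsw.ne_ab
        split_ifs with hvab
        · have h2 : nbrIn G L v ≤ nbrIn (switch G a x b y) L v + 1 := by
            rw [nbrIn, nbrIn, ← Finset.card_singleton (if v = a then x else y)]
            refine le_trans (Finset.card_le_card ?_) (Finset.card_union_le _ _)
            intro u hu
            simp only [Finset.mem_filter, Finset.mem_union, Finset.mem_singleton, hsw.adj_iff,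
              Sym2.eq_iff, Finset.mem_insert] at hu hvab ⊢
            grind
          have h3 : q * nbrIn G L v ≤ q * nbrIn (switch G a x b y) L v + q := by
            calc _ ≤ q * (nbrIn (switch G a x b y) L v + 1) := Nat.mul_le_mul_left _ h2
              _ = _ := by ring
          omega
        · have h2 : nbrIn G L v ≤ nbrIn (switch G a x b y) L v := by
            refine Finset.card_le_card ?_
            intro u hu
            simp only [Finset.mem_filter, hsw.adj_iff, Sym2.eq_iff, Finset.mem_insert,
              Finset.mem_singleton] at hu hvab ⊢
            grind
          have h3 := Nat.mul_le_mul_left q h2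
          omega
      refine (Finset.sum_le_sum h1).trans ?_
      rw [Finset.sum_add_distrib, ← Finset.sum_filter, Finset.sum_const, smul_eq_mul]
      have h2 : ((A ∪ B).filter fun v => v ∈ ({a, b} : Finset V)).card ≤ 2 :=
        (Finset.card_le_card fun v hv => (Finset.mem_filter.1 hv).2).trans Finset.card_le_two
      have h3 := hG.2.2
      nlinarith
  · intro G hG
    simp only [hP, Finset.mem_filter] at hG
    obtain ⟨hGd, hGe, hGs⟩ := hG
    have h1 := le_sum_weight_switchable k l D q T c M Δ r hq hc hM hn0 hGd hLl hAB hD hΔ hA hB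
      hrAB hDl hT hTr hMD hMΔ hMT (by omega) (hGs.trans (Nat.mul_le_mul_left _ hi.le))
    linarith
  · intro G hG
    simp only [hP, Finset.mem_filter] at hG
    obtain ⟨hGd, hGe, -⟩ := hG
    calc ∑ t ∈ _, w t ≤ ∑ t ∈ _, (1 : ℝ) := Finset.sum_le_sum fun t _ => min_le_left _ _
      _ = ((edgeCount G A B * edgeCount G Finset.univ Finset.univ : ℕ) : ℝ) := by
          rw [Finset.sum_const, nsmul_eq_mul, mul_one, Finset.card_product]; rfl
      _ ≤ _ := by
          rw [edgeCount_univ_right hGd]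
          have h1 : ((∑ v, d v : ℕ) : ℝ) ≤ k * n := by rw [hn]; exact_mod_cast hsum
          have h2 : edgeCount G A B ≤ 2 * T := by omega
          have h3 : (edgeCount G A B : ℝ) ≤ 2 * T := by exact_mod_cast h2
          rw [Nat.cast_mul]
          exact mul_le_mul h3 h1 (by positivity) (by positivity)

end CrossEdges

/-! ### Threshold sets, splitting along components, and percolation on a fixed graph -/

section Deterministic

open scoped Classical

variable {V : Type*}

/-- If `R` carries much of the weight of `d`, then for some threshold `t`, the vertices of `R` with
`t ≤ d v` still carry much weight and make up a positive proportion of those of `Y`. -/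
lemma exists_threshold (Y R : Finset V) (d : V → ℕ) (κ x : ℝ) (hκ : 0 ≤ κ) (hx : 0 < x)
    (hR : 2 * x ≤ ∑ v ∈ R, (d v : ℝ)) (hY : κ * ∑ v ∈ Y, (d v : ℝ) ≤ x) :
    ∃ t : ℕ, x ≤ ∑ v ∈ R.filter (fun v => t ≤ d v), (d v : ℝ) ∧
      κ * (Y.filter fun v => t ≤ d v).card ≤ (R.filter fun v => t ≤ d v).card := by
  by_contra! hcon
  have hex : ∃ t : ℕ, ∑ v ∈ R.filter (fun v => t + 1 ≤ d v), (d v : ℝ) < x := by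
    refine ⟨∑ v ∈ R, d v, ?_⟩
    rw [Finset.filter_false_of_mem]
    · simpa using hx
    · intro v hv
      have := Finset.single_le_sum (f := d) (fun _ _ => Nat.zero_le _) hv
      omega
  set τ := Nat.find hex with hτ
  have hτs := Nat.find_spec hex
  rw [← hτ] at hτs
  -- layer-cake decomposition of `d`, truncated at `τ`
  have hsum : ∀ v : V, ∑ t ∈ Finset.range τ, (if t + 1 ≤ d v then (1 : ℝ) else 0) =
      (min τ (d v) : ℕ) := by
    intro v
    rw [← Finset.sum_filter, Finset.sum_const, nsmul_eq_mul, mul_one]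
    congr 1
    rw [show (Finset.range τ).filter (fun t => t + 1 ≤ d v) = Finset.range (min τ (d v)) by
      ext t; simp, Finset.card_range]
  have hcard : ∀ C : Finset V, ∑ t ∈ Finset.range τ,
      ((C.filter fun v => t + 1 ≤ d v).card : ℝ) = ∑ v ∈ C, ((min τ (d v) : ℕ) : ℝ) := by
    intro C
    simp only [← hsum]
    rw [Finset.sum_comm]
    simp
  have h1 : ∑ v ∈ R, (d v : ℝ) ≤ ∑ v ∈ R, ((min τ (d v) : ℕ) : ℝ) +
      ∑ v ∈ R.filter (fun v => τ + 1 ≤ d v), (d v : ℝ) := by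
    rw [Finset.sum_filter, ← Finset.sum_add_distrib]
    refine Finset.sum_le_sum fun v _ => ?_
    split_ifs with h
    · have : (0 : ℝ) ≤ ((min τ (d v) : ℕ) : ℝ) := by positivity
      linarith
    · rw [min_eq_right (by omega), add_zero]
  have h2 : ∑ v ∈ R, ((min τ (d v) : ℕ) : ℝ) ≤ κ * ∑ v ∈ Y, (d v : ℝ) := by
    rw [← hcard]
    calc _ ≤ ∑ t ∈ Finset.range τ, κ * ((Y.filter fun v => t + 1 ≤ d v).card : ℝ) := by
          refine Finset.sum_le_sum fun t ht => (hcon (t + 1) ?_).le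
          have := Nat.find_min hex (Finset.mem_range.1 ht)
          exact not_lt.1 this
      _ = κ * ∑ v ∈ Y, ((min τ (d v) : ℕ) : ℝ) := by rw [← Finset.mul_sum, hcard]
      _ ≤ _ := by
          gcongr
          exact min_le_right _ _
  linarith

/-- A family of small weights can be split into two parts of comparable total weight. -/
lemma exists_subset_le_sum {ι : Type*} (s : Finset ι) (f : ι → ℝ) (y : ℝ) (hy : 0 < y)
    (hf : ∀ i ∈ s, f i ≤ y) (hs : 3 * y ≤ ∑ i ∈ s, f i) :
    ∃ u ⊆ s, y ≤ ∑ i ∈ u, f i ∧ y ≤ ∑ i ∈ s \ u, f i := by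
  obtain ⟨u, hu, hmin⟩ := (s.powerset.filter fun u => y ≤ ∑ i ∈ u, f i).exists_min_image
    Finset.card ⟨s, by simp; linarith⟩
  simp only [Finset.mem_filter, Finset.mem_powerset] at hu hmin
  refine ⟨u, hu.1, hu.2, ?_⟩
  have hne : u.Nonempty := by
    rw [Finset.nonempty_iff_ne_empty]
    rintro rfl
    simp at hu
    linarith
  obtain ⟨i, hi⟩ := hne
  have h1 : ∑ j ∈ u.erase i, f j < y := by
    by_contra! h
    have h2 := hmin (u.erase i) ⟨(Finset.erase_subset _ _).trans hu.1, h⟩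
    have h3 := Finset.card_erase_lt_of_mem hi
    omega
  have h2 := Finset.add_sum_erase u f hi
  have h3 := hf i (hu.1 hi)
  have h4 := Finset.sum_sdiff (f := f) hu.1
  linarith

/-- If all components of `H` are small, then `R` can be split along components into two parts with
many edges to `L` each. -/
lemma exists_split_of_small_components [Fintype V] (H : SimpleGraph V) (R L : Finset V) (l : ℕ)
    (y : ℝ) (hy : 0 < y) (hl : ∀ v ∈ L, H.degree v ≤ l)
    (hC : ∀ C : H.ConnectedComponent, (C.supp.ncard * l : ℝ) ≤ y)
    (hR : 3 * y ≤ edgeCount H R L) :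
    ∃ A ⊆ R, edgeCount H A (R \ A) = 0 ∧ y ≤ edgeCount H A L ∧ y ≤ edgeCount H (R \ A) L := by
  set f : H.ConnectedComponent → ℝ := fun C =>
    edgeCount H (R.filter fun v => H.connectedComponentMk v = C) L with hf
  have hsum : ∀ u : Finset H.ConnectedComponent, ∑ C ∈ u, f C =
      edgeCount H (R.filter fun v => H.connectedComponentMk v ∈ u) L := by
    intro u
    simp only [hf, edgeCount_eq_sum]
    rw [← Nat.cast_sum, ← Finset.sum_fiberwise_of_maps_to
      (s := R.filter fun v => H.connectedComponentMk v ∈ u) (t := u)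
      (g := H.connectedComponentMk) (fun v hv => (Finset.mem_filter.1 hv).2)]
    congr 1
    refine Finset.sum_congr rfl fun C hC => Finset.sum_congr ?_ fun _ _ => rfl
    ext v
    simp only [Finset.mem_filter]
    grind
  have hfy : ∀ C ∈ Finset.univ, f C ≤ y := by
    intro C _
    refine le_trans ?_ (hC C)
    simp only [hf]
    have h1 : edgeCount H (R.filter fun v => H.connectedComponentMk v = C) L ≤
        edgeCount H (L.filter fun v => H.connectedComponentMk v = C) Finset.univ := by
      rw [edgeCount_comm]
      refine Finset.card_le_card ?_
      rintro ⟨u, v⟩ huv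
      simp only [Finset.mem_filter, Finset.mem_product, Finset.mem_univ, and_true] at huv ⊢
      refine ⟨⟨huv.1.1, ?_⟩, huv.2⟩
      rw [← huv.1.2.2]
      exact SimpleGraph.ConnectedComponent.sound huv.2.reachable
    have h2 : edgeCount H (L.filter fun v => H.connectedComponentMk v = C) Finset.univ ≤
        (L.filter fun v => H.connectedComponentMk v = C).card * l := by
      rw [edgeCount_eq_sum, ← smul_eq_mul]
      refine Finset.sum_le_card_nsmul _ _ _ fun v hv => ?_
      rw [nbrIn_univ]
      exact hl v (Finset.mem_filter.1 hv).1
    have h3 : (L.filter fun v => H.connectedComponentMk v = C).card ≤ C.supp.ncard := by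
      rw [← Set.ncard_coe_finset]
      refine Set.ncard_le_ncard ?_ (Set.toFinite _)
      intro v hv
      simp only [Finset.coe_filter, Set.mem_ofPred_eq] at hv
      exact hv.2
    exact_mod_cast h1.trans (h2.trans (Nat.mul_le_mul_right _ h3))
  obtain ⟨u, -, hu1, hu2⟩ := exists_subset_le_sum Finset.univ f y hy hfy
    (by rw [hsum]; simpa using hR)
  have hsd : R \ R.filter (fun v => H.connectedComponentMk v ∈ u) =
      R.filter fun v => H.connectedComponentMk v ∈ Finset.univ \ u := by
    ext v; simp; tauto
  refine ⟨R.filter fun v => H.connectedComponentMk v ∈ u, Finset.filter_subset _ _, ?_,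
    by rwa [← hsum], by rwa [hsd, ← hsum]⟩
  rw [hsd, edgeCount, Finset.card_eq_zero, Finset.filter_eq_empty_iff]
  rintro ⟨v, w⟩ hvw hadj
  simp only [Finset.mem_product, Finset.mem_filter, Finset.mem_sdiff] at hvw
  refine hvw.2.2.2 ?_
  rw [← SimpleGraph.ConnectedComponent.sound hadj.reachable]
  exact hvw.1.2

lemma ncard_supp_le_largestComponentCard [Finite V] (H : SimpleGraph V) (C : H.ConnectedComponent) :
    C.supp.ncard ≤ largestComponentCard H :=
  le_ciSup (f := fun C : H.ConnectedComponent => C.supp.ncard) (Set.finite_range _).bddAbove C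

lemma degree_lt_largestComponentCard [Fintype V] (H : SimpleGraph V) (v : V) :
    H.degree v < largestComponentCard H := by
  refine lt_of_lt_of_le ?_
    (ncard_supp_le_largestComponentCard H (H.connectedComponentMk v))
  rw [← SimpleGraph.card_neighborFinset_eq_degree, ← Set.ncard_coe_finset]
  refine Set.ncard_lt_ncard ⟨?_, ?_⟩ (Set.toFinite _)
  · intro w hw
    simp only [SimpleGraph.coe_neighborFinset, SimpleGraph.mem_neighborSet] at hw
    exact (SimpleGraph.ConnectedComponent.sound hw.reachable).symm
  · intro h
    have := h (show v ∈ (H.connectedComponentMk v).supp from rfl)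
    simp at this

end Deterministic

section Percolation

open scoped Classical

lemma setBernoulli_real_card_filter_le {ι : Type*} [Finite ι] (u F : Finset ι) (hF : F ⊆ u)
    (p : unitInterval) (j : ℕ) :
    (setBernoulli (u : Set ι) p).real {s | (F.filter (· ∈ s)).card ≤ j} ≤
      2 ^ j * (1 - p / 2 : ℝ) ^ F.card := by
  have hp0 : (0 : ℝ) ≤ p := p.2.1
  have hp1 : (0 : ℝ) ≤ 1 - p := sub_nonneg.2 p.2.2
  set T := u.powerset.filter fun s => (F ∩ s).card ≤ j with hT
  have h1 : (setBernoulli (u : Set ι) p).real {s | (F.filter (· ∈ s)).card ≤ j} =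
      (setBernoulli (u : Set ι) p).real (⋃ s ∈ T, {(s : Set ι)}) := by
    rw [measureReal_def, setBernoulli_apply_eq_apply_subsets, measureReal_def]
    congr 2
    ext s
    simp only [Set.mem_ofPred_eq, Set.mem_iUnion, Set.mem_singleton_iff, exists_prop, hT,
      Finset.mem_filter, Finset.mem_powerset]
    constructor
    · rintro ⟨hs, hsu⟩
      refine ⟨u.filter (· ∈ s), ⟨Finset.filter_subset _ _, ?_⟩, ?_⟩
      · rwa [Finset.inter_filter, Finset.inter_eq_left.2 hF]
      · ext i; simpa using fun h => hsu h
    · rintro ⟨s, ⟨h1, h2⟩, rfl⟩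
      refine ⟨?_, by simpa using h1⟩
      simpa [Finset.filter_mem_eq_inter] using h2
  rw [h1]
  calc _ ≤ ∑ s ∈ T, (setBernoulli (u : Set ι) p).real {(s : Set ι)} :=
        measureReal_biUnion_finset_le _ _
    _ = ∑ s ∈ T, (p : ℝ) ^ s.card * (1 - p : ℝ) ^ (u \ s).card := by
        refine Finset.sum_congr rfl fun s hs => ?_
        have hsu := Finset.mem_powerset.1 (Finset.mem_filter.1 hs).1
        rw [setBernoulli_real_singleton p (by exact_mod_cast hsu) (Finset.finite_toSet u),
          ← Finset.coe_sdiff, Set.ncard_coe_finset, Set.ncard_coe_finset]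
    _ ≤ ∑ s ∈ T, 2 ^ j * ((∏ i ∈ s, if i ∈ F then (p / 2 : ℝ) else p) *
          ∏ i ∈ u \ s, (1 - p : ℝ)) := by
        refine Finset.sum_le_sum fun s hs => ?_
        have h2 := (Finset.mem_filter.1 hs).2
        have h3 : ∏ i ∈ s, (if i ∈ F then (p / 2 : ℝ) else p) =
            (1 / 2) ^ (F ∩ s).card * (p : ℝ) ^ s.card := by
          have : ∀ i, (if i ∈ F then (p / 2 : ℝ) else p) = (if i ∈ F then 1 / 2 else 1) * p := by
            intro i; split_ifs <;> ring
          simp only [this, Finset.prod_mul_distrib, Finset.prod_const, Finset.prod_ite]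
          rw [one_pow, mul_one, Finset.filter_mem_eq_inter, Finset.inter_comm]
        rw [h3, Finset.prod_const]
        have h4 : (1 : ℝ) ≤ 2 ^ j * (1 / 2) ^ (F ∩ s).card := by
          calc (1 : ℝ) = 2 ^ j * (1 / 2) ^ j := by rw [← mul_pow]; norm_num
            _ ≤ _ := mul_le_mul_of_nonneg_left
                (pow_le_pow_of_le_one (by norm_num) (by norm_num) h2) (by positivity)
        have h5 : (0 : ℝ) ≤ (p : ℝ) ^ s.card * (1 - p : ℝ) ^ (u \ s).card := by positivity
        nlinarith
    _ ≤ ∑ s ∈ u.powerset, 2 ^ j * ((∏ i ∈ s, if i ∈ F then (p / 2 : ℝ) else p) *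
          ∏ i ∈ u \ s, (1 - p : ℝ)) := by
        refine Finset.sum_le_sum_of_subset_of_nonneg (Finset.filter_subset _ _) fun s _ _ => ?_
        have : ∀ i, (0 : ℝ) ≤ if i ∈ F then (p / 2 : ℝ) else p := by
          intro i; split_ifs <;> positivity
        have := Finset.prod_nonneg (s := s) fun i _ => this i
        positivity
    _ = 2 ^ j * ∏ i ∈ u, ((if i ∈ F then (p / 2 : ℝ) else p) + (1 - p)) := by
        rw [← Finset.mul_sum, Finset.prod_add]
    _ = 2 ^ j * (1 - p / 2 : ℝ) ^ F.card := by
        congr 1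
        have : ∀ i, (if i ∈ F then (p / 2 : ℝ) else p) + (1 - p) =
            if i ∈ F then (1 - p / 2 : ℝ) else 1 := by
          intro i; split_ifs <;> ring
        simp only [this, Finset.prod_ite, Finset.prod_const]
        rw [one_pow, mul_one, Finset.filter_mem_eq_inter, Finset.inter_eq_right.2 hF]

variable {V : Type*} [Fintype V]

instance : MeasurableSingletonClass (SimpleGraph V) where
  measurableSet_singleton G := by
    have : {G} = SimpleGraph.edgeSet ⁻¹' {G.edgeSet} := by
      ext H; simp
    rw [this]
    exact SimpleGraph.measurable_edgeSet (MeasurableSet.singleton _)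

instance (G : SimpleGraph V) (p : unitInterval) : IsProbabilityMeasure (percolation G p) :=
  Measure.isProbabilityMeasure_map SimpleGraph.measurable_fromEdgeSet.aemeasurable

lemma percolation_not_le (G : SimpleGraph V) (p : unitInterval) :
    (percolation G p).real {H | ¬ H ≤ G} = 0 := by
  rw [measureReal_def, percolation,
    Measure.map_apply SimpleGraph.measurable_fromEdgeSet .of_discrete,
    setBernoulli_apply_eq_apply_subsets]
  convert ENNReal.toReal_zero
  convert measure_empty (μ := setBernoulli G.edgeSet p)
  ext s
  simp only [Set.mem_preimage, Set.mem_ofPred_eq, Set.mem_empty_iff_false, iff_false, not_and]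
  intro h hs
  apply h
  intro u v huv
  rw [SimpleGraph.fromEdgeSet_adj] at huv
  exact hs huv.1

/-- Exponential Markov bound for the number of retained edges between disjoint vertex sets. -/
lemma percolation_edgeCount_le (G : SimpleGraph V) (p : unitInterval) (A B : Finset V)
    (hAB : Disjoint A B) (j : ℕ) :
    (percolation G p).real {H | edgeCount H A B ≤ j} ≤
      2 ^ j * (1 - p / 2 : ℝ) ^ edgeCount G A B := by
  have hinj : Set.InjOn (fun e : V × V => s(e.1, e.2)) (A ×ˢ B : Finset (V × V)) := by
    rintro ⟨u, v⟩ huv ⟨u', v'⟩ huv' h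
    simp only [Finset.coe_product, Set.mem_prod, Finset.mem_coe] at huv huv'
    simp only [Sym2.eq_iff] at h
    rcases h with ⟨rfl, rfl⟩ | ⟨rfl, rfl⟩
    · rfl
    · exact absurd huv'.2 (Finset.disjoint_left.1 hAB huv.1)
  set F := ((A ×ˢ B).filter fun e => G.Adj e.1 e.2).image fun e : V × V => s(e.1, e.2) with hF
  have hFcard : F.card = edgeCount G A B :=
    Finset.card_image_of_injOn (hinj.mono (by exact_mod_cast Finset.filter_subset _ _))
  have hFG : F ⊆ G.edgeFinset := by
    intro e he
    simp only [hF, Finset.mem_image, Finset.mem_filter] at he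
    obtain ⟨⟨u, v⟩, ⟨-, h⟩, rfl⟩ := he
    simpa using h
  rw [← hFcard, measureReal_def, percolation,
    Measure.map_apply SimpleGraph.measurable_fromEdgeSet .of_discrete]
  refine le_trans ?_ (setBernoulli_real_card_filter_le G.edgeFinset F hFG p j)
  rw [SimpleGraph.coe_edgeFinset, measureReal_def]
  refine ENNReal.toReal_mono (measure_ne_top _ _) (measure_mono ?_)
  intro s hs
  simp only [Set.mem_preimage, Set.mem_ofPred_eq] at hs ⊢
  refine le_trans ?_ hs
  rw [hF, Finset.filter_image]
  refine Finset.card_image_le.trans (Finset.card_le_card ?_)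
  intro e he
  simp only [Finset.mem_filter, SimpleGraph.fromEdgeSet_adj] at he ⊢
  exact ⟨he.1.1, he.2, he.1.2.ne⟩

end Percolation

/-! ### Percolation given many edges across, and the union bounds -/

section Percolation

open scoped Classical

variable {V : Type*} [Fintype V]

lemma percolation_edgeCount_le_exp (G : SimpleGraph V) (p : unitInterval) (A B : Finset V)
    (hAB : Disjoint A B) (x : ℝ) (hx0 : 0 ≤ x) (hx : x ≤ edgeCount G A B) :
    (percolation G p).real {H | (edgeCount H A B : ℝ) ≤ p * x / 4} ≤ Real.exp (-(p * x / 4)) := by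
  have hp0 : (0 : ℝ) ≤ p := p.2.1
  have hp1 : (p : ℝ) ≤ 1 := p.2.2
  have h0 : 0 ≤ p * x / 4 := by positivity
  have h1 : (0 : ℝ) ≤ 1 - p / 2 := by linarith
  calc _ = (percolation G p).real {H | edgeCount H A B ≤ ⌊p * x / 4⌋₊} := by
        congr 1
        ext H
        exact (Nat.le_floor_iff h0).symm
    _ ≤ 2 ^ ⌊p * x / 4⌋₊ * (1 - p / 2 : ℝ) ^ edgeCount G A B :=
        percolation_edgeCount_le G p A B hAB _
    _ ≤ Real.exp (p * x / 4) * Real.exp (-(p * x / 2)) := by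
        gcongr
        · calc (2 : ℝ) ^ ⌊p * x / 4⌋₊ ≤ Real.exp 1 ^ ⌊p * x / 4⌋₊ := by
                gcongr
                linarith [Real.add_one_le_exp (1 : ℝ)]
            _ = Real.exp (⌊p * x / 4⌋₊) := by rw [← Real.exp_nat_mul, mul_one]
            _ ≤ _ := Real.exp_le_exp.2 (Nat.floor_le h0)
        · calc (1 - p / 2 : ℝ) ^ edgeCount G A B ≤ Real.exp (-(p / 2)) ^ edgeCount G A B := by
                gcongr
                linarith [Real.add_one_le_exp (-(p / 2 : ℝ))]
            _ = Real.exp (edgeCount G A B * -(p / 2)) := by rw [← Real.exp_nat_mul]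
            _ ≤ _ := Real.exp_le_exp.2 (by nlinarith)
    _ = _ := by rw [← Real.exp_add]; congr 1; ring

/-- A vertex of linear degree alone produces a large component. -/
lemma percolation_largestComponentCard_le_of_degree (G : SimpleGraph V) (p : unitInterval) (v : V)
    (x : ℝ) (hx0 : 0 ≤ x) (hx : x ≤ G.degree v) :
    (percolation G p).real {H | (largestComponentCard H : ℝ) ≤ p * x / 4} ≤
      Real.exp (-(p * x / 4)) := by
  have hdeg : ∀ H : SimpleGraph V, edgeCount H {v} {v}ᶜ = H.degree v := by
    intro H
    rw [edgeCount_eq_sum, Finset.sum_singleton, nbrIn, ← SimpleGraph.card_neighborFinset_eq_degree,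
      SimpleGraph.neighborFinset_eq_filter]
    congr 1
    ext w
    simp only [Finset.mem_filter, Finset.mem_compl, Finset.mem_singleton, Finset.mem_univ,
      true_and, and_iff_right_iff_imp]
    rintro h rfl
    exact H.loopless.irrefl _ h
  refine le_trans (measureReal_mono ?_) (percolation_edgeCount_le_exp G p {v} {v}ᶜ
    disjoint_compl_right x hx0 (by rwa [hdeg]))
  intro H hH
  simp only [Set.mem_ofPred_eq, hdeg] at hH ⊢
  have : (H.degree v : ℝ) ≤ largestComponentCard H := by
    exact_mod_cast (degree_lt_largestComponentCard H v).le
  linarith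

/-- If `G` has many edges between `R` and the low-degree set `L`, and many edges across every
partition of `R` into two parts seeing much of `L`, then percolation on `G` produces a large
component: otherwise the components would induce such a partition without any retained edge across,
which is excluded by a union bound. -/
lemma percolation_largestComponentCard_le_of_cross (G : SimpleGraph V) (p : unitInterval)
    (R L : Finset V) (hRL : Disjoint R L) (l T : ℕ) (N y z : ℝ) (hy : 0 < y) (hN0 : 0 ≤ N)
    (hl : ∀ v ∈ L, G.degree v ≤ l) (hz : z * l ≤ y) (hN : N ≤ edgeCount G R L)
    (hyN : 3 * y ≤ p * N / 4)
    (hT : ∀ A ⊆ R, y ≤ edgeCount G A L → y ≤ edgeCount G (R \ A) L → T ≤ edgeCount G A (R \ A)) :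
    (percolation G p).real {H | (largestComponentCard H : ℝ) ≤ z} ≤
      Real.exp (-(p * N / 4)) + 2 ^ R.card * (1 - p / 2 : ℝ) ^ T := by
  have hp0 : (0 : ℝ) ≤ p := p.2.1
  have hp1 : (p : ℝ) ≤ 1 := p.2.2
  set F := R.powerset.filter fun A => T ≤ edgeCount G A (R \ A) with hF
  have hsub : {H : SimpleGraph V | (largestComponentCard H : ℝ) ≤ z} ⊆
      ({H | ¬ H ≤ G} ∪ {H | (edgeCount H R L : ℝ) ≤ p * N / 4}) ∪
        ⋃ A ∈ F, {H | edgeCount H A (R \ A) ≤ 0} := by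
    intro H hH
    simp only [Set.mem_ofPred_eq] at hH
    by_contra hcon
    simp only [Set.mem_union, Set.mem_ofPred_eq, Set.mem_iUnion, not_or, not_not, not_exists,
      not_le] at hcon
    obtain ⟨⟨hHG, hHe⟩, hcross⟩ := hcon
    obtain ⟨A, hA, hA0, hA1, hA2⟩ := exists_split_of_small_components H R L l y hy
      (fun v hv => (SimpleGraph.degree_le_of_le hHG).trans (hl v hv)) (fun C => by
        refine le_trans ?_ hz
        gcongr
        exact le_trans (by exact_mod_cast ncard_supp_le_largestComponentCard H C) hH)
      (by linarith)
    refine absurd hA0 (hcross A ?_).ne'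
    rw [hF, Finset.mem_filter, Finset.mem_powerset]
    refine ⟨hA, hT A hA (hA1.trans ?_) (hA2.trans ?_)⟩
    · exact_mod_cast edgeCount_le_of_le hHG _ _
    · exact_mod_cast edgeCount_le_of_le hHG _ _
  calc _ ≤ (percolation G p).real _ := measureReal_mono hsub
    _ ≤ ((percolation G p).real {H | ¬ H ≤ G} +
          (percolation G p).real {H | (edgeCount H R L : ℝ) ≤ p * N / 4}) +
          ∑ A ∈ F, (percolation G p).real {H | edgeCount H A (R \ A) ≤ 0} := by
        refine (measureReal_union_le _ _).trans ?_
        gcongr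
        · exact measureReal_union_le _ _
        · exact measureReal_biUnion_finset_le _ _
    _ ≤ (0 + Real.exp (-(p * N / 4))) + ∑ A ∈ F, (1 - p / 2 : ℝ) ^ T := by
        gcongr with A hA
        · exact (percolation_not_le G p).le
        · exact percolation_edgeCount_le_exp G p R L hRL N hN0 hN
        · refine (percolation_edgeCount_le G p A (R \ A) Finset.disjoint_sdiff 0).trans ?_
          rw [pow_zero, one_mul]
          exact pow_le_pow_of_le_one (by linarith) (by linarith) (Finset.mem_filter.1 hA).2
    _ ≤ _ := by
        rw [zero_add, Finset.sum_const, nsmul_eq_mul]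
        have h1 : F.card ≤ 2 ^ R.card := by
          rw [← Finset.card_powerset]
          exact Finset.card_filter_le _ _
        have h2 : (F.card : ℝ) ≤ 2 ^ R.card := by exact_mod_cast h1
        have h3 : (0 : ℝ) ≤ 1 - p / 2 := by linarith
        gcongr

end Percolation

section ThresholdSets

open scoped Classical

variable {V : Type*}

/-- The nonempty sets of the form `{v ∈ Y | t ≤ d v}`. -/
noncomputable def thresholdSets (Y : Finset V) (d : V → ℕ) : Finset (Finset V) :=
  Y.powerset.filter fun Z => Z.Nonempty ∧ ∃ t, Z = Y.filter fun v => t ≤ d v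

/-- Threshold sets form a chain, so that there is at most one of each size. -/
lemma sum_pow_card_thresholdSets_le (Y : Finset V) (d : V → ℕ) (z : ℝ) (hz0 : 0 ≤ z)
    (hz : z ≤ 1 / 2) : ∑ Z ∈ thresholdSets Y d, z ^ Z.card ≤ 2 * z := by
  have hinj : Set.InjOn Finset.card (thresholdSets Y d : Set (Finset V)) := by
    intro Z hZ Z' hZ' h
    simp only [thresholdSets, Finset.coe_filter, Set.mem_ofPred_eq] at hZ hZ'
    obtain ⟨-, -, t, rfl⟩ := hZ
    obtain ⟨-, -, t', rfl⟩ := hZ'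
    rcases le_total t t' with htt | htt
    · exact (Finset.eq_of_subset_of_card_le
        (Finset.monotone_filter_right _ fun v _ hv => htt.trans hv) h.le).symm
    · exact Finset.eq_of_subset_of_card_le
        (Finset.monotone_filter_right _ fun v _ hv => htt.trans hv) h.ge
  calc ∑ Z ∈ thresholdSets Y d, z ^ Z.card
      = ∑ s ∈ (thresholdSets Y d).image Finset.card, z ^ s := (Finset.sum_image hinj).symm
    _ ≤ ∑ s ∈ (Finset.range Y.card).image (· + 1), z ^ s := by
        refine Finset.sum_le_sum_of_subset_of_nonneg ?_ fun _ _ _ => by positivity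
        intro s hs
        simp only [thresholdSets, Finset.mem_image, Finset.mem_filter, Finset.mem_powerset,
          Finset.mem_range] at hs ⊢
        obtain ⟨Z, ⟨hZY, hZ, -⟩, rfl⟩ := hs
        have h1 := Finset.card_le_card hZY
        have h2 := hZ.card_pos
        exact ⟨Z.card - 1, by omega, by omega⟩
    _ = z * ∑ s ∈ Finset.range Y.card, z ^ s := by
        rw [Finset.sum_image (fun _ _ _ _ h => Nat.succ_injective h), Finset.mul_sum]
        exact Finset.sum_congr rfl fun s _ => pow_succ' z s
    _ ≤ z * (1 - z)⁻¹ := by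
        gcongr
        rw [← tsum_geometric_of_lt_one hz0 (by linarith)]
        exact (summable_geometric_of_lt_one hz0 (by linarith)).sum_le_tsum _
          fun _ _ => by positivity
    _ ≤ z * 2 := by
        gcongr
        rw [inv_le_comm₀ (by linarith) (by norm_num)]
        linarith
    _ = 2 * z := by ring

variable [Fintype V] {d : V → ℕ}

/-- Disjoint subsets `A`, `B` of `Z` of total degree at least `c` each, with at least `r` vertices
altogether, all of which have a proportion `1 / q` of their neighbours in `L`. -/
structure IsHeavyPair (G : SimpleGraph V) (d : V → ℕ) (L Z A B : Finset V) (q : ℕ) (r c : ℝ) :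
    Prop where
  subset_left : A ⊆ Z
  subset_right : B ⊆ Z
  disjoint : Disjoint A B
  le_card : r ≤ A.card + B.card
  le_left : c ≤ ∑ v ∈ A, (d v : ℝ)
  le_right : c ≤ ∑ v ∈ B, (d v : ℝ)
  le_nbrIn : ∀ v ∈ A ∪ B, d v ≤ q * nbrIn G L v

/-- The union bound over all heavy pairs in all threshold sets. -/
lemma card_exists_heavyPair_few_cross_edges_le (k l D q K : ℕ) (c M Δ κ : ℝ) (Y L : Finset V)
    (hk : 1 ≤ k) (hq : 1 ≤ q) (hc : 0 < c) (hM : 0 < M) (hK : 3 ≤ K)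
    (hsum : ∑ v, d v ≤ k * Fintype.card V) (hn0 : 0 < Fintype.card V)
    (hLl : ∀ v ∈ L, d v ≤ l) (hLY : Disjoint L Y)
    (hD : ∀ v ∈ Y, D ≤ d v) (hΔ : ∀ v ∈ Y, (d v : ℝ) ≤ Δ)
    (hDl : 4 * q * (l + 1) ≤ D) (hDc : 8 * q * K * k ≤ D * c) (hDκ : 8 * q * K ≤ D * κ)
    (hMD : M ≤ D) (hMΔ : M * Δ ≤ k * Fintype.card V) (hMK : 272 * q ^ 2 * K * k ≤ κ * c * M) :
    (((realizations d).filter fun G => ∃ Z ∈ thresholdSets Y d, ∃ A B,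
      IsHeavyPair G d L Z A B q (κ * Z.card) (c * Fintype.card V) ∧
        edgeCount G A B < K * Z.card).card : ℝ) ≤
      2 * (4 * (1 / 2) ^ K) * (realizations d).card := by
  set n : ℝ := (Fintype.card V : ℝ) with hn
  have hnpos : 0 < n := by rw [hn]; exact_mod_cast hn0
  set E : Finset V → Finset V × Finset V → Finset (SimpleGraph V) := fun Z e =>
    (realizations d).filter fun G =>
      IsHeavyPair G d L Z e.1 e.2 q (κ * Z.card) (c * n) ∧ edgeCount G e.1 e.2 < K * Z.card with hE
  have hsub : ((realizations d).filter fun G => ∃ Z ∈ thresholdSets Y d, ∃ A B,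
      IsHeavyPair G d L Z A B q (κ * Z.card) (c * n) ∧ edgeCount G A B < K * Z.card) ⊆
      (thresholdSets Y d).biUnion fun Z => (Z.powerset ×ˢ Z.powerset).biUnion fun e => E Z e := by
    intro G hG
    simp only [Finset.mem_filter, Finset.mem_biUnion, Finset.mem_product, Finset.mem_powerset,
      hE] at hG ⊢
    obtain ⟨hGd, Z, hZ, A, B, h1, h2⟩ := hG
    exact ⟨Z, hZ, (A, B), ⟨h1.subset_left, h1.subset_right⟩, hGd, h1, h2⟩
  have hEcard : ∀ Z ∈ thresholdSets Y d, ∀ e, ((E Z e).card : ℝ) ≤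
      ((1 / 2) ^ K) ^ Z.card * (realizations d).card := by
    rintro Z hZ ⟨A, B⟩
    rcases (E Z (A, B)).eq_empty_or_nonempty with he | ⟨G₀, hG₀⟩
    · rw [he]; simp only [Finset.card_empty, Nat.cast_zero]; positivity
    simp only [hE, Finset.mem_filter] at hG₀
    obtain ⟨-, hp, -⟩ := hG₀
    simp only [thresholdSets, Finset.mem_filter, Finset.mem_powerset] at hZ
    have hsY : A ∪ B ⊆ Y := (Finset.union_subset hp.subset_left hp.subset_right).trans hZ.1
    have hZpos : (0 : ℝ) < Z.card := by exact_mod_cast hZ.2.1.card_pos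
    have hZD : (D : ℝ) * Z.card ≤ k * n := by
      have h1 : Z.card * D ≤ ∑ v ∈ Z, d v := by
        rw [← smul_eq_mul]
        exact Finset.card_nsmul_le_sum _ _ _ fun v hv => hD v (hZ.1 hv)
      have h2 : ∑ v ∈ Z, d v ≤ ∑ v, d v := Finset.sum_le_sum_of_subset (Finset.subset_univ _)
      have h3 : ((Z.card * D : ℕ) : ℝ) ≤ ((k * Fintype.card V : ℕ) : ℝ) := by
        exact_mod_cast h1.trans (h2.trans hsum)
      push_cast at h3
      linarith
    have hk' : (0 : ℝ) < k := by exact_mod_cast hk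
    have key := two_pow_mul_card_few_cross_edges_le (d := d) (A := A) (B := B) (L := L)
      k l D q (K * Z.card) c M Δ (κ * Z.card) hk hq hc hM hsum hn0 hLl hp.disjoint
      (Finset.disjoint_of_subset_right (hp.subset_left.trans hZ.1) hLY)
      (Finset.disjoint_of_subset_right (hp.subset_right.trans hZ.1) hLY)
      (fun v hv => hD v (hsY hv)) (fun v hv => hΔ v (hsY hv)) hp.le_left hp.le_right hp.le_card hDl
      ?_ ?_ hMD hMΔ ?_
    · have h1 : ((E Z (A, B)).card : ℝ) ≤ ((realizations d).filter fun G =>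
          edgeCount G A B < K * Z.card ∧ ∀ v ∈ A ∪ B, d v ≤ q * nbrIn G L v).card := by
        refine Nat.cast_le.2 (Finset.card_le_card ?_)
        intro G hG
        simp only [hE, Finset.mem_filter] at hG ⊢
        exact ⟨hG.1, hG.2.2, hG.2.1.le_nbrIn⟩
      rw [← pow_mul, one_div, inv_pow, inv_mul_eq_div, le_div_iff₀ (by positivity), mul_comm]
      refine le_trans ?_ key
      gcongr
    · push_cast
      refine le_of_mul_le_mul_right ?_ hk'
      calc 8 * (q : ℝ) * (K * Z.card) * k = (8 * q * K * k) * Z.card := by ring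
        _ ≤ D * c * Z.card := by gcongr
        _ = c * (D * Z.card) := by ring
        _ ≤ c * (k * n) := by gcongr
        _ = _ := by ring
    · push_cast
      calc 8 * (q : ℝ) * (K * Z.card) = (8 * q * K) * Z.card := by ring
        _ ≤ D * κ * Z.card := by gcongr
        _ = _ := by ring
    · push_cast
      calc 272 * (q : ℝ) ^ 2 * (K * Z.card) * k = (272 * q ^ 2 * K * k) * Z.card := by ring
        _ ≤ κ * c * M * Z.card := by gcongr
        _ = _ := by ring
  calc _ ≤ ((((thresholdSets Y d).biUnion fun Z =>
          (Z.powerset ×ˢ Z.powerset).biUnion fun e => E Z e).card : ℕ) : ℝ) := by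
        exact_mod_cast Finset.card_le_card hsub
    _ ≤ ∑ Z ∈ thresholdSets Y d, ∑ e ∈ Z.powerset ×ˢ Z.powerset, ((E Z e).card : ℝ) := by
        have := Finset.card_biUnion_le.trans (Finset.sum_le_sum fun Z (_ : Z ∈ thresholdSets Y d) =>
          (Finset.card_biUnion_le (s := Z.powerset ×ˢ Z.powerset) (t := fun e => E Z e)))
        exact_mod_cast this
    _ ≤ ∑ Z ∈ thresholdSets Y d, ∑ e ∈ Z.powerset ×ˢ Z.powerset,
          ((1 / 2) ^ K) ^ Z.card * ((realizations d).card : ℝ) :=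
        Finset.sum_le_sum fun Z hZ => Finset.sum_le_sum fun e _ => hEcard Z hZ e
    _ = (∑ Z ∈ thresholdSets Y d, (4 * (1 / 2) ^ K) ^ Z.card) * (realizations d).card := by
        rw [Finset.sum_mul]
        refine Finset.sum_congr rfl fun Z _ => ?_
        rw [Finset.sum_const, Finset.card_product, Finset.card_powerset, nsmul_eq_mul, mul_pow]
        push_cast
        rw [show (4 : ℝ) = 2 * 2 by norm_num, mul_pow]
        ring
    _ ≤ _ := by
        gcongr
        refine sum_pow_card_thresholdSets_le Y d _ (by positivity) ?_
        calc (4 : ℝ) * (1 / 2) ^ K ≤ 4 * (1 / 2) ^ 3 := by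
              gcongr 4 * ?_
              exact pow_le_pow_of_le_one (by norm_num) (by norm_num) hK
          _ = 1 / 2 := by norm_num

end ThresholdSets

/-! ### From typical graphs to the percolated random graph -/

section Assembly

open scoped Classical

/-- Percolation on a graph with many edges between `Y` and `L` and no heavy pair with few edges
across. The heavy pairs are found inside the set of vertices of `Y` having a fair share of their
neighbours in `L`, intersected with a suitable threshold set. -/
lemma percolation_largestComponentCard_le_of_heavyPairs {V : Type*} [Fintype V] {d : V → ℕ}
    (G : SimpleGraph V) (hG : G ∈ realizations d) (p : unitInterval) (hp : 0 < p) (Y L : Finset V)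
    (hLY : Disjoint L Y) (k l q K : ℕ) (c₀ c κ γ η : ℝ) (hk : 1 ≤ k) (hq1 : 1 ≤ q) (hc₀ : 0 < c₀)
    (hq : 2 * k ≤ q * c₀) (hc : c = p * c₀ / (48 * q)) (hκ : κ = c₀ / (4 * k)) (hγ : γ * l ≤ c)
    (hn0 : 0 < Fintype.card V) (hLl : ∀ v ∈ L, d v ≤ l) (hsum : ∑ v, d v ≤ k * Fintype.card V)
    (hYL : c₀ * Fintype.card V ≤ edgeCount G Y L)
    (hcross : ∀ Z ∈ thresholdSets Y d, ∀ A B,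
      IsHeavyPair G d L Z A B q (κ * Z.card) (c * Fintype.card V) → K * Z.card ≤ edgeCount G A B)
    (hη : η ≤ 1) (hK : 2 * (1 - p / 2 : ℝ) ^ K ≤ η) :
    (percolation G p).real {H | (largestComponentCard H : ℝ) ≤ γ * Fintype.card V} ≤
      Real.exp (-(p * (c₀ * Fintype.card V / (4 * q)) / 4)) + η := by
  set n : ℝ := (Fintype.card V : ℝ) with hn
  have hnpos : 0 < n := by rw [hn]; exact_mod_cast hn0
  have hk' : (0 : ℝ) < k := by exact_mod_cast hk
  have hq' : (0 : ℝ) < q := by exact_mod_cast hq1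
  have hp0 : (0 : ℝ) < p := hp
  have hp1 : (p : ℝ) ≤ 1 := p.2.2
  have hp2 : (0 : ℝ) ≤ 1 - p / 2 := by linarith
  have hdeg := mem_realizations.1 hG
  have hsum' : ∑ v, (d v : ℝ) ≤ k * n := by rw [hn]; exact_mod_cast hsum
  set R := Y.filter fun v => d v ≤ q * nbrIn G L v with hR
  have hRsum : 2 * (c₀ * n / 4) ≤ ∑ v ∈ R, (d v : ℝ) := by
    have h1 : (edgeCount G Y L : ℝ) = ∑ v ∈ R, (nbrIn G L v : ℝ) +
        ∑ v ∈ Y.filter (fun v => ¬ d v ≤ q * nbrIn G L v), (nbrIn G L v : ℝ) := by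
      rw [hR, Finset.sum_filter_add_sum_filter_not, edgeCount_eq_sum, Nat.cast_sum]
    have h2 : ∑ v ∈ R, (nbrIn G L v : ℝ) ≤ ∑ v ∈ R, (d v : ℝ) :=
      Finset.sum_le_sum fun v _ => by exact_mod_cast nbrIn_le_degree.trans (hdeg v).le
    have h3 : q * ∑ v ∈ Y.filter (fun v => ¬ d v ≤ q * nbrIn G L v), (nbrIn G L v : ℝ) ≤
        k * n := by
      rw [Finset.mul_sum]
      calc _ ≤ ∑ v ∈ Y.filter (fun v => ¬ d v ≤ q * nbrIn G L v), (d v : ℝ) :=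
            Finset.sum_le_sum fun v hv => by
              have := (Finset.mem_filter.1 hv).2
              exact_mod_cast (not_le.1 this).le
        _ ≤ ∑ v, (d v : ℝ) :=
            Finset.sum_le_sum_of_subset_of_nonneg (Finset.subset_univ _)
              fun _ _ _ => by positivity
        _ ≤ _ := hsum'
    have h4 : q * ∑ v ∈ Y.filter (fun v => ¬ d v ≤ q * nbrIn G L v), (nbrIn G L v : ℝ) ≤
        q * (c₀ * n / 2) := by nlinarith
    have h5 := le_of_mul_le_mul_left h4 hq'
    linarith
  have hYsum : κ * ∑ v ∈ Y, (d v : ℝ) ≤ c₀ * n / 4 := by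
    calc κ * ∑ v ∈ Y, (d v : ℝ) ≤ κ * (k * n) := by
          have : 0 ≤ κ := by rw [hκ]; positivity
          gcongr
          refine le_trans ?_ hsum'
          exact Finset.sum_le_sum_of_subset_of_nonneg (Finset.subset_univ _)
            fun _ _ _ => by positivity
      _ = _ := by rw [hκ]; field_simp
  obtain ⟨t, ht1, ht2⟩ := exists_threshold Y R d κ (c₀ * n / 4) (by rw [hκ]; positivity)
    (by positivity) hRsum hYsum
  set Z := Y.filter fun v => t ≤ d v with hZ
  set S := R.filter fun v => t ≤ d v with hS
  have hSY : S ⊆ Y := (Finset.filter_subset _ _).trans (Finset.filter_subset _ _)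
  have hSZ : S ⊆ Z := Finset.filter_subset_filter _ (Finset.filter_subset _ _)
  have hZne : Z.Nonempty := by
    refine Finset.Nonempty.mono hSZ ?_
    rw [Finset.nonempty_iff_ne_empty]
    intro h0
    rw [h0, Finset.sum_empty] at ht1
    have : 0 < c₀ * n / 4 := by positivity
    linarith
  have hZthr : Z ∈ thresholdSets Y d := by
    simp only [thresholdSets, Finset.mem_filter, Finset.mem_powerset]
    exact ⟨Finset.filter_subset _ _, hZne, t, rfl⟩
  have hSL : c₀ * n / (4 * q) ≤ edgeCount G S L := by
    rw [div_le_iff₀ (by positivity), edgeCount_eq_sum, Nat.cast_sum]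
    have : ∑ v ∈ S, (d v : ℝ) ≤ q * ∑ v ∈ S, (nbrIn G L v : ℝ) := by
      rw [Finset.mul_sum]
      refine Finset.sum_le_sum fun v hv => ?_
      exact_mod_cast (Finset.mem_filter.1 (Finset.mem_filter.1 hv).1).2
    linarith
  have hcpos : 0 < c := by rw [hc]; positivity
  have hdL : ∀ A : Finset V, (edgeCount G A L : ℝ) ≤ ∑ v ∈ A, (d v : ℝ) := by
    intro A
    have h1 := edgeCount_mono (G := G) (Finset.Subset.refl A) (Finset.subset_univ L)
    rw [edgeCount_univ_right hG] at h1
    exact_mod_cast h1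
  refine (percolation_largestComponentCard_le_of_cross G p S L
    (Finset.disjoint_of_subset_left hSY hLY.symm) l (K * Z.card) (c₀ * n / (4 * q)) (c * n) (γ * n)
    (by positivity) (by positivity) (fun v hv => (hdeg v).trans_le (hLl v hv)) ?_ hSL ?_ ?_).trans ?_
  · calc γ * n * l = γ * l * n := by ring
      _ ≤ c * n := by gcongr
  · rw [hc]
    apply le_of_eq
    field_simp
    norm_num
  · intro A hA hA1 hA2
    refine hcross Z hZthr A (S \ A) ⟨hA.trans hSZ, Finset.sdiff_subset.trans hSZ,
      Finset.disjoint_sdiff, ht2.trans (le_of_eq ?_), hA1.trans (hdL _), hA2.trans (hdL _), ?_⟩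
    · have := Finset.card_sdiff_add_card_eq_card hA
      rw [← this]
      push_cast
      ring
    · intro v hv
      rw [Finset.union_sdiff_of_subset hA] at hv
      exact (Finset.mem_filter.1 (Finset.mem_filter.1 hv).1).2
  · gcongr
    have hη0 : 0 ≤ 2 * (1 - p / 2 : ℝ) ^ K := by positivity
    calc (2 : ℝ) ^ S.card * (1 - p / 2 : ℝ) ^ (K * Z.card)
        ≤ 2 ^ Z.card * (1 - p / 2 : ℝ) ^ (K * Z.card) := by
          gcongr
          norm_num
      _ = (2 * (1 - p / 2 : ℝ) ^ K) ^ Z.card := by rw [mul_pow, pow_mul]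
      _ ≤ η ^ Z.card := by gcongr
      _ ≤ η := pow_le_of_le_one (hη0.trans hK) hη hZne.card_pos.ne'

lemma coe_realizations {n : ℕ} (d : Fin n → ℕ) :
    (realizations d : Set (SimpleGraph (Fin n))) = graphsWithDegrees d := by
  ext G
  simp [realizations, graphsWithDegrees]

/-- If all graphs with degree sequence `d` outside an exceptional set `X` percolate well, then so
does a uniformly random one. -/
lemma one_sub_le_percolatedGraphLaw {n : ℕ} (d : Fin n → ℕ) (p : unitInterval)
    (hd : (graphsWithDegrees d).Nonempty) (x θ η : ℝ) (hη : 0 ≤ η)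
    (X : Finset (SimpleGraph (Fin n))) (hX : X ⊆ realizations d)
    (hXcard : (X.card : ℝ) ≤ θ * (realizations d).card)
    (h : ∀ G ∈ realizations d, G ∉ X →
      (percolation G p).real {H | (largestComponentCard H : ℝ) ≤ x} ≤ η) :
    1 - (θ + η) ≤ (percolatedGraphLaw d p).real {H | x < (largestComponentCard H : ℝ)} := by
  have hne : (realizations d).Nonempty := by
    rw [← Finset.coe_nonempty, coe_realizations]; exact hd
  have hcard : (0 : ℝ) < (realizations d).card := by exact_mod_cast hne.card_pos
  have := isProbabilityMeasure_uniformOn (Set.toFinite (graphsWithDegrees d)) hd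
  have hmeas : AEMeasurable (fun G => percolation G p) (uniformOn (graphsWithDegrees d)) :=
    (measurable_of_finite _).aemeasurable
  have hprob : IsProbabilityMeasure (percolatedGraphLaw d p) := ⟨by
    rw [percolatedGraphLaw, Measure.bind_apply .univ hmeas]
    simp⟩
  have hθ : 0 ≤ θ := by
    by_contra! hneg
    have : (0 : ℝ) ≤ X.card := by positivity
    nlinarith
  have hcompl : {H : SimpleGraph (Fin n) | x < (largestComponentCard H : ℝ)} =
      {H | (largestComponentCard H : ℝ) ≤ x}ᶜ := by
    ext H; simp
  rw [hcompl, probReal_compl_eq_one_sub .of_discrete]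
  have hle : percolatedGraphLaw d p {H | (largestComponentCard H : ℝ) ≤ x} ≤
      ENNReal.ofReal (θ + η) := by
    rw [percolatedGraphLaw, Measure.bind_apply .of_discrete hmeas]
    calc ∫⁻ G, percolation G p {H | (largestComponentCard H : ℝ) ≤ x}
          ∂(uniformOn (graphsWithDegrees d))
        ≤ ∫⁻ G, ((X : Set (SimpleGraph (Fin n))).indicator 1 G + ENNReal.ofReal η)
          ∂(uniformOn (graphsWithDegrees d)) := by
          refine lintegral_mono_ae ?_
          have hae : ∀ᵐ G ∂(uniformOn (graphsWithDegrees d)), G ∈ graphsWithDegrees d :=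
            ae_cond_mem .of_discrete
          filter_upwards [hae] with G hG
          rw [← coe_realizations, Finset.mem_coe] at hG
          by_cases hGX : G ∈ X
          · refine le_trans prob_le_one ?_
            simp [hGX]
          · refine le_trans ?_ le_add_self
            rw [← ofReal_measureReal]
            exact ENNReal.ofReal_le_ofReal (h G hG hGX)
      _ = uniformOn (graphsWithDegrees d) X + ENNReal.ofReal η := by
          rw [lintegral_add_left (measurable_of_finite _), lintegral_indicator_one .of_discrete]
          simp
      _ ≤ ENNReal.ofReal θ + ENNReal.ofReal η := by
          gcongr
          rw [← coe_realizations, uniformOn_apply_finset, Finset.inter_eq_right.2 hX]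
          rw [ENNReal.div_le_iff (by simpa using hne.ne_empty) (by simp),
            ← ENNReal.ofReal_natCast, ← ENNReal.ofReal_natCast, ← ENNReal.ofReal_mul hθ]
          exact ENNReal.ofReal_le_ofReal hXcard
      _ = _ := (ENNReal.ofReal_add hθ hη).symm
  have := ENNReal.toReal_le_of_le_ofReal (by linarith) hle
  rw [measureReal_def]
  linarith

end Assembly

/-! ### The choice of constants -/

section Assembly

open scoped Classical

/-- The case of bounded maximum degree, for a degree sequence with sum at most `k n`, in terms of
all the constants of the argument. -/
lemma one_sub_le_percolatedGraphLaw_of_degree_le {n : ℕ} (hnpos : 0 < n) (d : Fin n → ℕ)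
    (hd : IsDegreeSequence d) (p : unitInterval) (hp0 : 0 < p) (k q K D t : ℕ)
    (δ ε c₀ c κ M Δ γ : ℝ) (hδ0 : 0 < δ) (hδ1 : δ < 1) (hε0 : 0 < ε) (hε1 : ε < 1)
    (hk1 : 1 ≤ k) (hq1 : 1 ≤ q) (hc₀ : c₀ = ε / (48 * k)) (hq : 2 * k ≤ q * c₀)
    (hc : c = p * c₀ / (48 * q)) (hκ : κ = c₀ / (4 * k)) (hK3 : 3 ≤ K)
    (hK1 : 2 * (1 - p / 2 : ℝ) ^ K ≤ δ / 8) (hK2 : 2 * (4 * (1 / 2 : ℝ) ^ K) ≤ δ / 8)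
    (ht : (1 / 2 : ℝ) ^ t < δ / 8) (hM : 272 * q ^ 2 * K * k ≤ κ * c * M) (hMpos : 0 < M)
    (hMD : M ≤ D) (hDc : 8 * q * K * k ≤ D * c) (hDκ : 8 * q * K ≤ D * κ)
    (hDl : 4 * q * (2 * k + 1) + (2 * k + 1) ≤ D) (hMΔ : M * Δ ≤ k * n)
    (hγ : γ * (2 * k : ℕ) ≤ c) (hmax : ∀ v, (d v : ℝ) ≤ Δ)
    (hsum : ∑ v, d v ≤ k * n)
    (hWsum : ε * n ≤ ∑ v with 2 * D ≤ d v, (d v : ℝ))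
    (hn2 : Real.exp (-(p * (c₀ / (4 * q)) / 4 * n)) ≤ δ / 8) (hn4 : 48 * k * t ≤ ε / 2 * n) :
    1 - δ ≤ (percolatedGraphLaw d p).real {H | γ * n < (largestComponentCard H : ℝ)} := by
  have hcard : Fintype.card (Fin n) = n := Fintype.card_fin n
  have hk0 : (0 : ℝ) < k := by exact_mod_cast hk1
  have hqpos : (0 : ℝ) < q := by exact_mod_cast hq1
  have hp0' : (0 : ℝ) < p := hp0
  have hc₀pos : 0 < c₀ := by rw [hc₀]; positivity
  have hcpos : 0 < c := by rw [hc]; positivity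
  have hsumN : ∑ v, d v ≤ k * Fintype.card (Fin n) := by rwa [hcard]
  set L : Finset (Fin n) := Finset.univ.filter fun v => d v ≤ 2 * k with hL
  set Y : Finset (Fin n) := Finset.univ.filter fun v => D ≤ d v with hY
  set W : Finset (Fin n) := Finset.univ.filter fun v => 2 * D ≤ d v with hW
  have hLY : Disjoint L Y := by
    rw [Finset.disjoint_filter]
    intro v _ h1 h2
    omega
  have hLcard : Fintype.card (Fin n) ≤ 2 * L.card := by
    have h1 := Finset.card_filter_add_card_filter_not (s := (Finset.univ : Finset (Fin n)))
      (fun v => d v ≤ 2 * k)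
    have h2 : (Finset.univ.filter fun v => ¬ d v ≤ 2 * k).card * (2 * k) ≤ k * n := by
      rw [hcard] at hsumN
      refine le_trans ?_ hsumN
      rw [← smul_eq_mul]
      refine (Finset.card_nsmul_le_sum _ d _ fun v hv => ?_).trans
        (Finset.sum_le_sum_of_subset (Finset.subset_univ _))
      have := (Finset.mem_filter.1 hv).2
      omega
    have h3 : (Finset.univ.filter fun v => ¬ d v ≤ 2 * k).card * 2 ≤ n := by
      refine Nat.le_of_mul_le_mul_left ?_ hk1
      linarith
    rw [Finset.card_univ, hcard] at h1
    rw [hcard, hL]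
    omega
  have hfew := two_pow_mul_card_few_edges_le (d := d) k (2 * k) D t ε (c₀ * n) Y W L hk1 hε0.le
    hε1.le rfl (by omega) hsumN (fun v _ => hd.one_le v) (fun v hv => (Finset.mem_filter.1 hv).2)
    hLcard hLY
    (fun v hv => by simp only [hW, hY, Finset.mem_filter, Finset.mem_univ, true_and] at hv ⊢; omega)
    (fun v hv => (Finset.mem_filter.1 hv).2)
    (fun v hv => by simpa [hY] using hv) (by rwa [hcard]) (by
      rw [hcard]
      have : 24 * k * (c₀ * n) = ε / 2 * n := by rw [hc₀]; field_simp; norm_num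
      linarith)
  have hcross := card_exists_heavyPair_few_cross_edges_le (d := d) k (2 * k) D q K c M Δ κ
    Y L hk1 hq1 hcpos hMpos hK3 hsumN (by rwa [hcard])
    (fun v hv => (Finset.mem_filter.1 hv).2) hLY (fun v hv => (Finset.mem_filter.1 hv).2)
    (fun v _ => hmax v) (by omega) hDc hDκ hMD
    (by rwa [hcard]) hM
  rw [hcard] at hcross
  set X₁ := (realizations d).filter fun G => (edgeCount G Y L : ℝ) ≤ c₀ * n with hX₁
  set X₂ := (realizations d).filter fun G => ∃ Z ∈ thresholdSets Y d, ∃ A B,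
    IsHeavyPair G d L Z A B q (κ * Z.card) (c * n) ∧ edgeCount G A B < K * Z.card with hX₂
  have h := one_sub_le_percolatedGraphLaw d p hd.feasible (γ * n) (δ / 8 + δ / 8) (δ / 8 + δ / 8)
    (by positivity) (X₁ ∪ X₂)
    (Finset.union_subset (Finset.filter_subset _ _) (Finset.filter_subset _ _)) ?_ ?_
  · linarith
  · have h1 : (X₁.card : ℝ) ≤ δ / 8 * (realizations d).card := by
      calc (X₁.card : ℝ) = (1 / 2) ^ t * (2 ^ t * X₁.card) := by
            rw [one_div, inv_pow, inv_mul_cancel_left₀ (by positivity)]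
        _ ≤ (1 / 2) ^ t * (realizations d).card := mul_le_mul_of_nonneg_left hfew (by positivity)
        _ ≤ _ := mul_le_mul_of_nonneg_right ht.le (Nat.cast_nonneg _)
    have h2 : (X₂.card : ℝ) ≤ δ / 8 * (realizations d).card := 
      hcross.trans (mul_le_mul_of_nonneg_right hK2 (Nat.cast_nonneg _))
    have h3 : ((X₁ ∪ X₂).card : ℝ) ≤ X₁.card + X₂.card := by
      exact_mod_cast Finset.card_union_le _ _
    linarith
  · intro G hG hGX
    simp only [Finset.mem_union, hX₁, hX₂, Finset.mem_filter, hG, true_and, not_or, not_le,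
      not_exists, not_and, not_lt] at hGX
    have h := percolation_largestComponentCard_le_of_heavyPairs G hG p hp0 Y L hLY k (2 * k) q K
      c₀ c κ γ (δ / 8) hk1 hq1 hc₀pos (by linarith) hc hκ hγ (by rwa [hcard])
      (fun v hv => (Finset.mem_filter.1 hv).2) hsumN (by rw [hcard]; exact hGX.1.le)
      (by rw [hcard]; exact hGX.2) (by linarith) hK1
    rw [hcard] at h
    refine h.trans ?_
    gcongr
    refine le_trans (le_of_eq ?_) hn2
    congr 2
    ring

end Assembly

end DegreePercolation

open DegreePercolation in
theorem proposition4p3 (p : unitInterval) (hp0 : 0 < p) (hp1 : p < 1)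
    (δ : ℝ) (hδ : δ ∈ Set.Ioo (0 : ℝ) 1) (ε : ℝ) (hε : ε ∈ Set.Ioo (0 : ℝ) 1)
    (dbar : ℝ) (hdbar : 1 ≤ dbar) :
    ∃ γ : ℝ, 0 < γ ∧ ∃ n₀ : ℕ, 1 ≤ n₀ ∧
      ∀ n : ℕ, n₀ ≤ n → ∀ d : Fin n → ℕ, IsDegreeSequence d →
        (∑ i, (d i : ℝ)) ≤ dbar * n →
        ε * n ≤ ∑ i ∈ highDegree (Real.log n ^ 2) d, (d i : ℝ) →
          1 - δ ≤ (percolatedGraphLaw d p).real {H | γ * n < (largestComponentCard H : ℝ)} := by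
  classical
  obtain ⟨hδ0, hδ1⟩ := hδ
  obtain ⟨hε0, hε1⟩ := hε
  have hp0' : (0 : ℝ) < p := hp0
  have hp1' : (p : ℝ) < 1 := hp1
  obtain ⟨k, hk⟩ : ∃ k : ℕ, dbar ≤ k := exists_nat_ge dbar
  have hkpos : (1 : ℝ) ≤ k := hdbar.trans hk
  have hk1 : 1 ≤ k := by exact_mod_cast hkpos
  have hk0 : (0 : ℝ) < k := by linarith
  set c₀ : ℝ := ε / (48 * k) with hc₀
  have hc₀pos : 0 < c₀ := by positivity
  obtain ⟨q, hq⟩ : ∃ q : ℕ, 2 * k / c₀ ≤ q := exists_nat_ge _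
  have hqpos : (0 : ℝ) < q := lt_of_lt_of_le (by positivity) hq
  have hq1 : 1 ≤ q := by exact_mod_cast hqpos
  rw [div_le_iff₀ hc₀pos] at hq
  set c : ℝ := p * c₀ / (48 * q) with hc
  have hcpos : 0 < c := by positivity
  set κ : ℝ := c₀ / (4 * k) with hκ
  have hκpos : 0 < κ := by positivity
  -- `K` beats the number of pairs of subsets in the union bounds
  obtain ⟨K, hK3, hK1, hK2⟩ : ∃ K : ℕ, 3 ≤ K ∧ 2 * (1 - p / 2 : ℝ) ^ K ≤ δ / 8 ∧
      2 * (4 * (1 / 2 : ℝ) ^ K) ≤ δ / 8 := by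
    have h1 : Filter.Tendsto (fun K : ℕ => 2 * (1 - p / 2 : ℝ) ^ K) Filter.atTop (nhds (2 * 0)) :=
      (tendsto_pow_atTop_nhds_zero_of_lt_one (by linarith) (by linarith)).const_mul 2
    have h2 : Filter.Tendsto (fun K : ℕ => 2 * (4 * (1 / 2 : ℝ) ^ K)) Filter.atTop
        (nhds (2 * (4 * 0))) :=
      ((tendsto_pow_atTop_nhds_zero_of_lt_one (by norm_num) (by norm_num)).const_mul 4).const_mul 2
    have hδ8 : 0 < δ / 8 := by positivity
    rw [mul_zero] at h1
    rw [mul_zero, mul_zero] at h2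
    exact ((Filter.eventually_ge_atTop 3).and ((h1.eventually_le_const hδ8).and
      (h2.eventually_le_const hδ8))).exists
  -- the number of switchings showing that few edges between `Y` and `L` are unlikely
  obtain ⟨t, ht⟩ : ∃ t : ℕ, (1 / 2 : ℝ) ^ t < δ / 8 :=
    exists_pow_lt_of_lt_one (by positivity) (by norm_num)
  have hKpos : (0 : ℝ) < K := by exact_mod_cast (show 0 < K by omega)
  set M : ℝ := 272 * q ^ 2 * K * k / (κ * c) with hM
  have hMpos : 0 < M := by positivity
  obtain ⟨D, hD⟩ : ∃ D : ℕ, M + 8 * q * K * k / c + 8 * q * K / κ +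
      (4 * q * (2 * k + 1) + (2 * k + 1) : ℕ) ≤ D := exists_nat_ge _
  have hD1 : 0 ≤ 8 * q * K * k / c := by positivity
  have hD2 : 0 ≤ 8 * q * K / κ := by positivity
  have hD3 : (0 : ℝ) ≤ (4 * q * (2 * k + 1) + (2 * k + 1) : ℕ) := by positivity
  have hDl : 4 * q * (2 * k + 1) + (2 * k + 1) ≤ D := by
    have : ((4 * q * (2 * k + 1) + (2 * k + 1) : ℕ) : ℝ) ≤ D := by linarith
    exact_mod_cast this
  -- if all degrees are below `γ' n`, then `M * d v ≤ k * n` for all `v`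
  set γ' : ℝ := k / M with hγ'
  have hγ'pos : 0 < γ' := by positivity
  have hγpos : 0 < min (p * γ' / 4) (c / (2 * k : ℕ)) :=
    lt_min (by positivity) (div_pos hcpos (by push_cast; positivity))
  refine ⟨min (p * γ' / 4) (c / (2 * k : ℕ)), hγpos, ?_⟩
  set γ := min (p * γ' / 4) (c / (2 * k : ℕ)) with hγ
  have hcast := tendsto_natCast_atTop_atTop (R := ℝ)
  have hexp : ∀ a : ℝ, 0 < a → ∀ b : ℝ, 0 < b →
      ∀ᶠ n : ℕ in Filter.atTop, Real.exp (-(a * n)) ≤ b := by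
    intro a ha b hb
    have h1 : Filter.Tendsto (fun n : ℕ => Real.exp (-(a * n))) Filter.atTop (nhds 0) :=
      Real.tendsto_exp_neg_atTop_nhds_zero.comp (hcast.const_mul_atTop ha)
    exact h1.eventually_le_const hb
  have hlog : ∀ᶠ n : ℕ in Filter.atTop, (2 * D : ℝ) ≤ Real.log n ^ 2 :=
    ((Filter.tendsto_pow_atTop (n := 2) (by norm_num)).comp
      (Real.tendsto_log_atTop.comp hcast)).eventually_ge_atTop _
  have hlarge : ∀ᶠ n : ℕ in Filter.atTop, (48 * k * t / (ε / 2) : ℝ) ≤ n :=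
    hcast.eventually_ge_atTop _
  obtain ⟨n₀, hn₀⟩ := Filter.eventually_atTop.1 ((((hexp (p * γ' / 4) (by positivity) δ hδ0).and
    (hexp (p * (c₀ / (4 * q)) / 4) (by positivity) (δ / 8) (by positivity))).and hlog).and hlarge)
  refine ⟨max n₀ 1, le_max_right _ _, ?_⟩
  intro n hn d hd hsum hhigh
  obtain ⟨⟨⟨hn1, hn2⟩, hn3⟩, hn4⟩ := hn₀ n ((le_max_left _ _).trans hn)
  have hnpos : 0 < n := (le_max_right _ _).trans hn
  have hnpos' : (0 : ℝ) < n := by exact_mod_cast hnpos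
  by_cases hmax : ∃ v, γ' * n ≤ d v
  · -- a vertex of linear degree
    obtain ⟨v, hv⟩ := hmax
    have h := one_sub_le_percolatedGraphLaw d p hd.feasible (γ * n) 0 δ hδ0.le ∅
      (Finset.empty_subset _) (by simp) ?_
    · simpa using h
    · intro G hG _
      refine le_trans (measureReal_mono ?_) ((percolation_largestComponentCard_le_of_degree G p v
        (γ' * n) (by positivity) (by rwa [mem_realizations.1 hG v])).trans (le_trans ?_ hn1))
      · intro H hH
        simp only [Set.mem_ofPred_eq] at hH ⊢
        refine hH.trans ?_
        calc γ * n ≤ p * γ' / 4 * n := by gcongr; exact min_le_left _ _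
          _ = _ := by ring
      · apply le_of_eq; congr 2; ring
  push Not at hmax
  have hsumN : ∑ v, d v ≤ k * n := by
    have : ((∑ v, d v : ℕ) : ℝ) ≤ (k * n : ℕ) := by
      push_cast
      exact hsum.trans (by gcongr)
    exact_mod_cast this
  have hMD : M ≤ D := by linarith
  have hDc : 8 * q * K * k ≤ D * c := by
    rw [← div_le_iff₀ hcpos]; linarith
  have hDκ : 8 * q * K ≤ D * κ := by
    rw [← div_le_iff₀ hκpos]; linarith
  refine one_sub_le_percolatedGraphLaw_of_degree_le hnpos d hd p hp0 k q K D t δ ε c₀ c κ M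
    (γ' * n) γ hδ0 hδ1 hε0 hε1 hk1 hq1 hc₀ (by linarith) hc hκ hK3 hK1 hK2 ht ?_ hMpos hMD hDc hDκ
    hDl ?_ ?_ (fun v => (hmax v).le) hsumN (hhigh.trans ?_) hn2 ?_
  · rw [hM, mul_div_cancel₀ _ (by positivity)]
  · rw [hγ', ← mul_assoc, mul_div_cancel₀ _ hMpos.ne']
  · have h2k : (0 : ℝ) < (2 * k : ℕ) := by push_cast; positivity
    calc γ * (2 * k : ℕ) ≤ c / (2 * k : ℕ) * (2 * k : ℕ) := by gcongr; exact min_le_right _ _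
      _ = c := div_mul_cancel₀ _ h2k.ne'
  · refine Finset.sum_le_sum_of_subset_of_nonneg ?_ fun _ _ _ => by positivity
    intro v hv
    simp only [highDegree, Finset.mem_filter, Finset.mem_univ, true_and] at hv ⊢
    exact_mod_cast hn3.trans hv
  · rwa [div_le_iff₀ (by positivity), mul_comm (n : ℝ)] at hn4
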